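/- Let $\mathbb D=\{z\in\mathbb C:|z|<1\}$, $\mathbb T=\partial\mathbb D$, and write $$d_{\mathbb D}(x,z)=\log\frac{1+\left|\frac{z-x}{1-\bar x z}\right|}{1-\left|\frac{z-x}{1-\bar x z}\right|},\qquad d\mu_{\mathbb D}(z)=\frac{dV(z)}{(1-|z|^2)^2},\qquad P_x(\zeta)=\frac{1-|x|^2}{|x-\zeta|^2}\quad(x,z\in\mathbb D,\ \zeta\in\mathbb T),$$ where $dV$ is Lebesgue measure. Let $L^2(\mathbb T)=L^2(\mathbb T,\frac{d\theta}{2\pi})$, and let $h^2(\mathbb D)$ be the space of harmonic functions $f:\mathbb D\to\mathbb C$ with $\sup_{0<r<1}\int_0^{2\pi}|f(re^{i\theta})|^2\frac{d\theta}{2\pi}<\infty$. A configuration $X$ on $\mathbb D$ is a collection of points of $\mathbb D$, possibly with multiplicities and without regard to order, having only finitely many points in every relatively compact subset of $\mathbb D$; sums over $x\in X$ are taken with multiplicity. A point process on $\mathbb D$ is a probability measure $\Pi$ on the space $\mathrm{Conf}(\mathbb D)$ of configurations, equipped with the smallest $\sigma$-algebra making the counting maps $X\mapsto\#_B(X)$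 measurable for all relatively compact Borel sets $B\subset\mathbb D$. Its first intensity measure is $B\mapsto\mathbb E_\Pi[\#_B]$, $B\subset\mathbb D$ Borel. **Theorem.** Let $\Pi$ be a point process on $\mathbb D$ whose first intensity measure is $\lambda\mu_{\mathbb D}$ for a constant $\lambda>0$. Suppose that there is a constant $C$ such that, for every Borel function $f:\mathbb D\to\mathbb C$ with $\mathbb E_\Pi\big[\sum_{x\in X}(|f(x)|+|f(x)|^2)\big]<\infty$, $$\mathrm{Var}_\Pi\Big(\sum_{x\in X}f(x)\Big)\le C\,\mathbb E_\Pi\Big(\sum_{x\in X}|f(x)|^2\Big).$$ Then for $\Pi$-almost every $X\in\mathrm{Conf}(\mathbb D)$ the following hold. 1. For every $s>1$ and every $z\in\mathbb D$, the series $\sum_{x\in X}e^{-s\,d_{\mathbb D}(x,z)}P_x$ converges unconditionally in $L^2(\mathbb T)$. 2. For every $z\in\mathbb D$, one has $0<\sum_{x\in X}e^{-s\,d_{\mathbb D}(x,z)}<\infty$ for every $s>1$, and $$\lim_{s\to1^+}\left\|\frac{\sum_{x\in X}e^{-s\,d_{\mathbb D}(x,z)}P_x}{\sum_{x\in X}e^{-s\,d_{\mathbb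 D}(x,z)}}-P_z\right\|_{L^2(\mathbb T)}=0.$$ 3. For every $f\in h^2(\mathbb D)$ and every $z\in\mathbb D$, the series $\sum_{x\in X}e^{-s\,d_{\mathbb D}(x,z)}f(x)$ converges absolutely for every $s>1$, and $$f(z)=\lim_{s\to1^+}\frac{\sum_{x\in X}e^{-s\,d_{\mathbb D}(x,z)}f(x)}{\sum_{x\in X}e^{-s\,d_{\mathbb D}(x,z)}}.$$ -/

import Mathlib

open MeasureTheory Filter Topology Set
open scoped ENNReal NNReal ComplexConjugate

noncomputable section

/-! ### Configurations and point processes -/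

/-- A configuration on `E`: a locally finite collection of points with multiplicities, without
regard to order. It is recorded by its multiplicity function (`mult x = 0` means that `x` does not
belong to the configuration); every compact set contains only finitely many points. -/
@[ext]
structure Conf (E : Type*) [TopologicalSpace E] where
  mult : E → ℕ
  locallyFinite : ∀ K : Set E, IsCompact K → {x | x ∈ K ∧ mult x ≠ 0}.Finite

namespace Conf

variable {E : Type*} [TopologicalSpace E]

/-- The points of the configuration `X`, each one repeated according to its multiplicity. A sum
over `x ∈ X` is a sum over `p : X.Point`, the location of `p` being `p.1`. -/
abbrev Point (X : Conf E) : Type _ := Σ x : E, Fin (X.mult x)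

/-- The number of points of `X` in `B`, counted with multiplicity. -/
def count (B : Set E) (X : Conf E) : ℝ≥0∞ :=
  ∑' p : X.Point, B.indicator (fun _ => (1 : ℝ≥0∞)) p.1

/-- The smallest sigma-algebra on the space of configurations for which all the counting maps
`X ↦ #_B(X)`, with `B` a relatively compact Borel set, are measurable. -/
instance instMeasurableSpace [MeasurableSpace E] : MeasurableSpace (Conf E) :=
  ⨆ (B : Set E) (_ : MeasurableSet B) (_ : ∃ K, IsCompact K ∧ B ⊆ K),
    MeasurableSpace.comap (count B) inferInstance

end Conf

section PointProcess

variable {E : Type*} [TopologicalSpace E] [MeasurableSpace E]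

/-- `ξ` is the first intensity measure of the point process with law `P`: the expected number of
points in each Borel set `B` is `ξ B`. -/
def HasFirstIntensity (P : Measure (Conf E)) (ξ : Measure E) : Prop :=
  ∀ B : Set E, MeasurableSet B → ∫⁻ X, X.count B ∂P = ξ B

/-- The variance `𝔼 |S - 𝔼 S| ^ 2` of a complex random variable `S`. -/
def complexVariance {Ω : Type*} [MeasurableSpace Ω] (S : Ω → ℂ) (P : Measure Ω) : ℝ≥0∞ :=
  ∫⁻ ω, ‖S ω - ∫ ω', S ω' ∂P‖ₑ ^ 2 ∂P

/-- The bound on the variance of linear statistics: there is a constant `C` such that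
`Var (∑_{x ∈ X} f x) ≤ C * 𝔼 (∑_{x ∈ X} |f x| ^ 2)` for every (Borel) function `f : E → ℂ` with
`𝔼 (∑_{x ∈ X} (|f x| + |f x| ^ 2)) < ∞`. -/
def HasVarianceBound (P : Measure (Conf E)) : Prop :=
  ∃ C : ℝ≥0, ∀ f : E → ℂ, Measurable f →
    ∫⁻ X, ∑' p : X.Point, (‖f p.1‖ₑ + ‖f p.1‖ₑ ^ 2) ∂P < ∞ →
      complexVariance (fun X : Conf E => ∑' p : X.Point, f p.1) P
        ≤ C * ∫⁻ X, ∑' p : X.Point, ‖f p.1‖ₑ ^ 2 ∂P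

end PointProcess

/-! ### The disk -/

/-- The open unit disk, with its usual topology and Borel sigma-algebra. -/
abbrev Disk : Type := Metric.ball (0 : ℂ) 1

/-- The Lobachevsky (Poincaré) distance on the unit disk. -/
def lobachevskyDist (x z : Disk) : ℝ :=
  Real.log ((1 + ‖((z : ℂ) - x) / (1 - conj (x : ℂ) * z)‖)
    / (1 - ‖((z : ℂ) - x) / (1 - conj (x : ℂ) * z)‖))

/-- The hyperbolic area measure `dV(z) / (1 - |z|²)²`, where `dV` is Lebesgue measure. -/
def diskVolume : Measure Disk :=
  ((volume : Measure ℂ).comap (fun z : Disk => (z : ℂ))).withDensity fun z => ENNReal.ofReal (1 / (1 - ‖(z : ℂ)‖ ^ 2) ^ 2)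

/-! ### The circle and the Poisson kernel -/

instance Circle.instMeasurableSpace : MeasurableSpace Circle := borel Circle

instance Circle.instBorelSpace : BorelSpace Circle := ⟨rfl⟩

/-- The measure `dθ / 2π` on the unit circle. -/
def circleMeasure : Measure Circle :=
  (ENNReal.ofReal (2 * Real.pi))⁻¹ •
    (volume.restrict (Ioc (0 : ℝ) (2 * Real.pi))).map fun θ => Circle.exp θ

instance : IsFiniteMeasure circleMeasure := by
  have h : (ENNReal.ofReal (2 * Real.pi))⁻¹ ≠ ∞ := by
    simp [Real.pi_pos]
  unfold circleMeasure
  exact Measure.smul_finite _ h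

/-- The function `P_x(ζ) = (1 - |x|²) / |x - ζ|²` on the circle, for `x` in the disk. -/
def poissonC (x : Disk) : C(Circle, ℂ) where
  toFun ζ := (poissonKernel 0 (x : ℂ) (ζ : ℂ) : ℂ)
  continuous_toFun := by
    have hx : ‖(x : ℂ)‖ < 1 := mem_ball_zero_iff.mp x.2
    simp only [poissonKernel_def]
    refine Complex.continuous_ofReal.comp (Continuous.div (by fun_prop) (by fun_prop) ?_)
    intro ζ h
    have h' : (ζ : ℂ) = x := by simpa [sub_eq_zero] using h
    rw [← h', Circle.norm_coe] at hx
    exact lt_irrefl _ hx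

/-- `P_x` as an element of `L²(𝕋, dθ / 2π)`. -/
def poissonL2 (x : Disk) : Lp ℂ 2 circleMeasure :=
  ContinuousMap.toLp 2 circleMeasure ℂ (poissonC x)

/-- The harmonic Hardy space `h²(𝔻)`: complex-valued harmonic functions on the disk whose circular
means `∫ |f(r e^{iθ})|² dθ / 2π`, `0 < r < 1`, are bounded. (The values outside the disk of the
function `f` on `ℂ` play no role.) -/
def harmonicHardy : Set (ℂ → ℂ) :=
  {f | InnerProductSpace.HarmonicOnNhd f (Metric.ball 0 1) ∧
    BddAbove ((fun r : ℝ => Real.circleAverage (fun z => ‖f z‖ ^ 2) 0 r) '' Ioo 0 1)}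

/-- The Patterson–Sullivan weight `e^{-s d(x, z)}`. -/
def psWeight (s : ℝ) (z x : Disk) : ℝ := Real.exp (-s * lobachevskyDist x z)

end

/-!
Write `e^{-d(x, z)}` for the weight of a point `x` of the disk seen from `z`, and
`V_s(z) = ∑_{x ∈ X} e^{-s d(x, z)} P_x` for the weighted sum of Poisson kernels.

*First moment.* The hyperbolic area is invariant under the Möbius involution exchanging `0` and `z`,
and `x ↦ P_x(ζ)` is harmonic, so the mean value property gives
`𝔼 V_s(z)(ζ) = λ c(s) P_z(ζ)` with `c(s) = π / (2 (s² - 1))`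
(`lintegral_psWeight_mul_poissonKernel`, `lintegral_poissonSeries`).

*Second moment.* Since `P_x(ζ) ≤ e^{d(x, 0)}`, the function `x ↦ e^{-s d(x, z)} P_x(ζ)` is bounded for
`s ≥ 1`, and its second moment is at most a constant times its first moment. The variance bound, applied
for each `ζ` and integrated over the circle, yields `𝔼 ‖V_s(z) - λ c(s) P_z‖² = O(c(s))`
(`lintegral_lintegral_poissonSeries_sub_sq_le`). After division by `(λ c(s))²` this is `O(s - 1)`, hence
summable along `s_n = 1 + (n + 1)⁻²`, and `V_{s_n}(z) / (λ c(s_n)) → P_z` in `L²(𝕋)` almost surely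
(`ae_summable_and_tendsto_psExponent`). In particular the pointwise sum of the nonnegative terms lies in
`L²(𝕋)`, which gives unconditional convergence, although the series need not converge absolutely.

*All `s` and all `z` at once.* Because the Poisson kernels are nonnegative, the norm of a combination
of them is monotone in the absolute values of the coefficients (`norm_sum_smul_poissonL2_le`). The
weights decrease in `s` and `c(s_{n+1}) / c(s_n) → 1`, so the sequence `s_n` can be replaced by `s → 1⁺`
(`tendsto_poissonSum_of_tendsto_seq`); and the ratio of the weights seen from two nearby points `z`, `w`
is close to `1` uniformly in `x`, so a countable dense set of base points suffices
(`tendsto_poissonSum_of_dense`).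

*Harmonic functions.* By the Poisson formula on smaller disks and weak-* compactness, every
`f ∈ h²(𝔻)` has the form `f x = φ (P_x)` with `φ` a bounded functional on `L²(𝕋)`
(`exists_functional_of_mem_harmonicHardy`). Applying `φ` to the convergence of `V_s(z)` gives the
reconstruction of `f z`, for all `f` outside a single null set. The case `f = 1` identifies the limit of
the normalizing sums, so these may replace `λ c(s)`; it also shows that `X` is not empty.
-/

/-! ### The Lobachevsky distance and the weights -/

namespace Disk

theorem norm_lt_one (x : Disk) : ‖(x : ℂ)‖ < 1 := mem_ball_zero_iff.mp x.2

theorem one_sub_norm_sq_pos (x : Disk) : 0 < 1 - ‖(x : ℂ)‖ ^ 2 := by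
  have := x.norm_lt_one
  nlinarith [norm_nonneg (x : ℂ)]

theorem norm_one_sub_conj_mul_pos (x z : Disk) : 0 < ‖1 - conj (x : ℂ) * z‖ := by
  rw [norm_pos_iff, sub_ne_zero]
  intro h
  have h1 : ‖conj (x : ℂ) * z‖ = 1 := by rw [← h]; simp
  rw [norm_mul, RCLike.norm_conj] at h1
  nlinarith [x.norm_lt_one, z.norm_lt_one, norm_nonneg (x : ℂ), norm_nonneg (z : ℂ)]

theorem norm_sq_sub_norm_sq (x z : ℂ) :
    ‖1 - conj x * z‖ ^ 2 - ‖z - x‖ ^ 2 = (1 - ‖x‖ ^ 2) * (1 - ‖z‖ ^ 2) := by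
  simp only [← Complex.normSq_eq_norm_sq, Complex.normSq_apply]
  simp
  ring

/-- `e^{-d(x, z)}` in a closed form without logarithms, see `psWeight_eq`. -/
noncomputable def expNegDist (z x : Disk) : ℝ :=
  (1 - ‖(x : ℂ)‖ ^ 2) * (1 - ‖(z : ℂ)‖ ^ 2) / (‖1 - conj (x : ℂ) * z‖ + ‖(z : ℂ) - x‖) ^ 2

theorem expNegDist_pos (z x : Disk) : 0 < expNegDist z x := by
  have := norm_one_sub_conj_mul_pos x z
  have := x.one_sub_norm_sq_pos
  have := z.one_sub_norm_sq_pos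
  unfold expNegDist
  positivity

theorem expNegDist_le_one (z x : Disk) : expNegDist z x ≤ 1 := by
  have h := norm_one_sub_conj_mul_pos x z
  unfold expNegDist
  rw [← norm_sq_sub_norm_sq, div_le_one (by positivity)]
  nlinarith [norm_nonneg ((z : ℂ) - x)]

theorem exp_neg_lobachevskyDist (x z : Disk) :
    Real.exp (-lobachevskyDist x z) = expNegDist z x := by
  have h := norm_one_sub_conj_mul_pos x z
  have h2 := norm_sq_sub_norm_sq (x : ℂ) z
  have h3 : 0 < (1 - ‖(x : ℂ)‖ ^ 2) * (1 - ‖(z : ℂ)‖ ^ 2) :=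
    mul_pos x.one_sub_norm_sq_pos z.one_sub_norm_sq_pos
  have h4 : ‖(z : ℂ) - x‖ < ‖1 - conj (x : ℂ) * z‖ := by
    apply lt_of_pow_lt_pow_left₀ 2 h.le
    linarith
  unfold lobachevskyDist expNegDist
  rw [norm_div, ← h2]
  generalize ‖(z : ℂ) - x‖ = b at *
  generalize ‖1 - conj (x : ℂ) * z‖ = a at *
  have hab : a - b ≠ 0 := by linarith
  have hb : 0 < 1 - b / a := by rw [sub_pos, div_lt_one h]; exact h4
  by_cases hb0 : a + b = 0
  · exact absurd (show b / a = -1 by rw [div_eq_iff h.ne']; linarith) (by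
      intro h5
      rw [eq_neg_of_add_eq_zero_right hb0] at h2
      nlinarith)
  have hpos : 0 < a ^ 2 - b ^ 2 := by rw [h2]; exact h3
  have hab' : 0 < a + b := by nlinarith
  have h1 : 0 < 1 + b / a := by
    have : 1 + b / a = (a + b) / a := by field_simp
    rw [this]; positivity
  rw [← Real.log_inv, Real.exp_log (by positivity)]
  field_simp
  ring

theorem psWeight_eq (s : ℝ) (z x : Disk) : psWeight s z x = expNegDist z x ^ s := by
  unfold psWeight
  rw [← exp_neg_lobachevskyDist, ← Real.exp_mul]
  ring_nf

theorem psWeight_pos (s : ℝ) (z x : Disk) : 0 < psWeight s z x := Real.exp_pos _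

/-- The weights decrease in the exponent because the distance is nonnegative. -/
theorem psWeight_anti {s t : ℝ} (h : s ≤ t) (z x : Disk) : psWeight t z x ≤ psWeight s z x := by
  rw [psWeight_eq, psWeight_eq]
  exact Real.rpow_le_rpow_of_exponent_ge (expNegDist_pos z x) (expNegDist_le_one z x) h

/-- A constant with `e^{-d(x, z)} ≤ harnackConst z w * e^{-d(x, w)}` for every `x`, which tends to
`1` as `w → z`. -/
noncomputable def harnackConst (z w : Disk) : ℝ :=
  (1 - ‖(z : ℂ)‖ ^ 2) / (1 - ‖(w : ℂ)‖ ^ 2) * (1 + 2 * ‖(z : ℂ) - w‖ / (1 - ‖(z : ℂ)‖)) ^ 2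

theorem harnackConst_pos (z w : Disk) : 0 < harnackConst z w := by
  have := z.one_sub_norm_sq_pos
  have := w.one_sub_norm_sq_pos
  have := sub_pos.mpr z.norm_lt_one
  unfold harnackConst
  positivity

@[simp]
theorem harnackConst_self (z : Disk) : harnackConst z z = 1 := by
  have := z.one_sub_norm_sq_pos.ne'
  simp [harnackConst, this]

theorem continuous_harnackConst : Continuous fun p : Disk × Disk => harnackConst p.1 p.2 := by
  unfold harnackConst
  have h1 : ∀ p : Disk × Disk, 1 - ‖(p.2 : ℂ)‖ ^ 2 ≠ 0 := fun p => p.2.one_sub_norm_sq_pos.ne'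
  have h2 : ∀ p : Disk × Disk, 1 - ‖(p.1 : ℂ)‖ ≠ 0 := fun p => (sub_pos.mpr p.1.norm_lt_one).ne'
  fun_prop (disch := assumption)

theorem expNegDist_le_harnackConst_mul (z w x : Disk) :
    expNegDist z x ≤ harnackConst z w * expNegDist w x := by
  have hz := z.one_sub_norm_sq_pos
  have hw := w.one_sub_norm_sq_pos
  have hx := x.one_sub_norm_sq_pos
  have hz1 := sub_pos.mpr z.norm_lt_one
  have hA := norm_one_sub_conj_mul_pos x z
  have hB := norm_one_sub_conj_mul_pos x w
  have hx1 : ‖(x : ℂ)‖ ≤ 1 := x.norm_lt_one.le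
  -- the denominator is a `2`-Lipschitz function of the base point, bounded below by `1 - |z|`
  have h1 : ‖1 - conj (x : ℂ) * w‖ ≤ ‖1 - conj (x : ℂ) * z‖ + ‖(z : ℂ) - w‖ := by
    calc ‖1 - conj (x : ℂ) * w‖ = ‖(1 - conj (x : ℂ) * z) + conj (x : ℂ) * (z - w)‖ := by ring_nf
      _ ≤ ‖1 - conj (x : ℂ) * z‖ + ‖conj (x : ℂ) * (z - w)‖ := norm_add_le _ _
      _ ≤ _ := by
        rw [norm_mul, RCLike.norm_conj]
        gcongr
        exact mul_le_of_le_one_left (norm_nonneg _) hx1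
  have h2 : ‖(w : ℂ) - x‖ ≤ ‖(z : ℂ) - x‖ + ‖(z : ℂ) - w‖ := by
    rw [norm_sub_rev (z : ℂ) w, add_comm]
    exact norm_sub_le_norm_sub_add_norm_sub _ _ _
  have h3 : 1 - ‖(z : ℂ)‖ ≤ ‖1 - conj (x : ℂ) * z‖ := by
    have : ‖conj (x : ℂ) * z‖ ≤ ‖(z : ℂ)‖ := by
      rw [norm_mul, RCLike.norm_conj]
      exact mul_le_of_le_one_left (norm_nonneg _) hx1
    have h4 := norm_sub_norm_le (1 : ℂ) (conj (x : ℂ) * z)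
    rw [norm_one] at h4
    linarith
  unfold expNegDist harnackConst
  set A := ‖1 - conj (x : ℂ) * z‖ + ‖(z : ℂ) - x‖ with hAdef
  set B := ‖1 - conj (x : ℂ) * w‖ + ‖(w : ℂ) - x‖ with hBdef
  have hA0 : 0 < A := by positivity
  have hB0 : 0 < B := by positivity
  have hAz : 1 - ‖(z : ℂ)‖ ≤ A := by linarith [norm_nonneg ((z : ℂ) - x)]
  have hBA : B ≤ A * (1 + 2 * ‖(z : ℂ) - w‖ / (1 - ‖(z : ℂ)‖)) := by
    have : 2 * ‖(z : ℂ) - w‖ ≤ A * (2 * ‖(z : ℂ) - w‖ / (1 - ‖(z : ℂ)‖)) := by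
      rw [mul_div_assoc', le_div_iff₀ hz1, mul_comm]
      gcongr
    linarith
  rw [div_le_iff₀ (by positivity)]
  have hsq := pow_le_pow_left₀ hB0.le hBA 2
  have : (1 - ‖(z : ℂ)‖ ^ 2) / (1 - ‖(w : ℂ)‖ ^ 2) *
      (1 + 2 * ‖(z : ℂ) - w‖ / (1 - ‖(z : ℂ)‖)) ^ 2 *
        ((1 - ‖(x : ℂ)‖ ^ 2) * (1 - ‖(w : ℂ)‖ ^ 2) / B ^ 2) * A ^ 2 =
      (1 - ‖(x : ℂ)‖ ^ 2) * (1 - ‖(z : ℂ)‖ ^ 2) *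
        ((A * (1 + 2 * ‖(z : ℂ) - w‖ / (1 - ‖(z : ℂ)‖))) ^ 2 / B ^ 2) := by
    field_simp
  rw [this]
  refine le_mul_of_one_le_right (by positivity) ?_
  rwa [one_le_div (by positivity)]

theorem psWeight_le_harnackConst_mul {s : ℝ} (hs : 0 ≤ s) (z w x : Disk) :
    psWeight s z x ≤ harnackConst z w ^ s * psWeight s w x := by
  rw [psWeight_eq, psWeight_eq, ← Real.mul_rpow (harnackConst_pos z w).le (expNegDist_pos w x).le]
  exact Real.rpow_le_rpow (expNegDist_pos z x).le (expNegDist_le_harnackConst_mul z w x) hs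

/-- A constant for the relative oscillation of the weights under a change of the base point,
see `abs_psWeight_sub_le`. -/
noncomputable def harnackOsc (z w : Disk) : ℝ :=
  (max 1 (max (harnackConst z w) (harnackConst w z))) ^ 2 - 1

theorem harnackOsc_nonneg (z w : Disk) : 0 ≤ harnackOsc z w :=
  sub_nonneg.mpr (one_le_pow₀ (le_max_left _ _))

theorem tendsto_harnackOsc (z : Disk) : Tendsto (fun w => harnackOsc z w) (𝓝 z) (𝓝 0) := by
  have h : Continuous fun w => harnackOsc z w := by
    have h1 : Continuous fun w => harnackConst z w :=
      continuous_harnackConst.comp (f := fun w => (z, w)) (by fun_prop)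
    have h2 : Continuous fun w => harnackConst w z :=
      continuous_harnackConst.comp (f := fun w => (w, z)) (by fun_prop)
    exact ((continuous_const.max (h1.max h2)).pow 2).sub continuous_const
  simpa [harnackOsc] using h.tendsto z

theorem abs_psWeight_sub_le {s : ℝ} (hs : 0 ≤ s) (hs2 : s ≤ 2) (z w x : Disk) :
    |psWeight s z x - psWeight s w x| ≤ harnackOsc z w * psWeight s w x := by
  set L := max 1 (max (harnackConst z w) (harnackConst w z)) with hL
  have hL1 : 1 ≤ L := le_max_left _ _
  have hLs : 1 ≤ L ^ s := Real.one_le_rpow hL1 hs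
  have hLs2 : L ^ s ≤ L ^ 2 :=
    (Real.rpow_le_rpow_of_exponent_le hL1 hs2).trans_eq (Real.rpow_two L)
  have h1 : psWeight s z x ≤ L ^ s * psWeight s w x := by
    refine (psWeight_le_harnackConst_mul hs z w x).trans ?_
    exact mul_le_mul_of_nonneg_right (Real.rpow_le_rpow (harnackConst_pos z w).le
      ((le_max_left _ _).trans (le_max_right _ _)) hs) (psWeight_pos s w x).le
  have h2 : psWeight s w x ≤ L ^ s * psWeight s z x := by
    refine (psWeight_le_harnackConst_mul hs w z x).trans ?_
    exact mul_le_mul_of_nonneg_right (Real.rpow_le_rpow (harnackConst_pos w z).le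
      ((le_max_right _ _).trans (le_max_right _ _)) hs) (psWeight_pos s z x).le
  have hw := psWeight_pos s w x
  unfold harnackOsc
  rw [← hL, abs_le]
  constructor
  · -- `1 - L^{-s} ≤ L^s - 1`
    have h3 : psWeight s w x * (2 - L ^ s) ≤ psWeight s z x := by
      have h4 : psWeight s w x / L ^ s ≤ psWeight s z x := by
        rw [div_le_iff₀ (by positivity)]; linarith
      have h5 : 2 - L ^ s ≤ 1 / L ^ s := by
        rw [le_div_iff₀ (by positivity)]; nlinarith [sq_nonneg (L ^ s - 1)]
      calc _ ≤ psWeight s w x * (1 / L ^ s) := by gcongr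
        _ = psWeight s w x / L ^ s := by ring
        _ ≤ _ := h4
    nlinarith
  · nlinarith

theorem continuous_expNegDist (z : Disk) : Continuous (expNegDist z) := by
  unfold expNegDist
  have h : ∀ x : Disk, (‖1 - conj (x : ℂ) * z‖ + ‖(z : ℂ) - x‖) ^ 2 ≠ 0 := fun x => by
    have := norm_one_sub_conj_mul_pos x z
    positivity
  have : Continuous fun x : Disk => conj (x : ℂ) :=
    Complex.continuous_conj.comp continuous_subtype_val
  fun_prop (disch := assumption)

theorem continuous_psWeight (s : ℝ) (z : Disk) : Continuous (psWeight s z) := by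
  have : psWeight s z = fun x => expNegDist z x ^ s := funext (psWeight_eq s z)
  rw [this]
  exact (continuous_expNegDist z).rpow_const fun x => Or.inl (expNegDist_pos z x).ne'

/-! ### Möbius involutions -/

/-- The involution `x ↦ (z - x) / (1 - z̄ x)` of the disk, which exchanges `0` and `z`. -/
noncomputable def moebius (z x : Disk) : Disk :=
  ⟨((z : ℂ) - x) / (1 - conj (z : ℂ) * x), by
    have h := norm_one_sub_conj_mul_pos z x
    rw [mem_ball_zero_iff, norm_div, div_lt_one h]
    apply lt_of_pow_lt_pow_left₀ 2 h.le
    have h2 := norm_sq_sub_norm_sq (z : ℂ) x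
    have h3 : 0 < (1 - ‖(z : ℂ)‖ ^ 2) * (1 - ‖(x : ℂ)‖ ^ 2) :=
      mul_pos z.one_sub_norm_sq_pos x.one_sub_norm_sq_pos
    rw [norm_sub_rev]
    linarith⟩

theorem coe_moebius (z x : Disk) :
    (moebius z x : ℂ) = ((z : ℂ) - x) / (1 - conj (z : ℂ) * x) := rfl

theorem one_sub_conj_mul_ne_zero (z x : Disk) : 1 - conj (z : ℂ) * x ≠ 0 :=
  norm_pos_iff.mp (norm_one_sub_conj_mul_pos z x)

@[simp]
theorem moebius_moebius (z x : Disk) : moebius z (moebius z x) = x := by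
  ext
  have h := one_sub_conj_mul_ne_zero z x
  have h2 := one_sub_conj_mul_ne_zero z (moebius z x)
  rw [coe_moebius, div_eq_iff h2, coe_moebius]
  generalize conj (z : ℂ) = w at *
  have h3 : (1 - w * x) * ((z - x) / (1 - w * x)) = (z : ℂ) - x := mul_div_cancel₀ _ h
  linear_combination -h3

theorem one_sub_norm_moebius_sq (z x : Disk) :
    1 - ‖(moebius z x : ℂ)‖ ^ 2 =
      (1 - ‖(z : ℂ)‖ ^ 2) * (1 - ‖(x : ℂ)‖ ^ 2) / ‖1 - conj (z : ℂ) * x‖ ^ 2 := by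
  have h := (norm_one_sub_conj_mul_pos z x).ne'
  rw [coe_moebius, norm_div, ← norm_sq_sub_norm_sq, norm_sub_rev (z : ℂ) x, div_pow, sub_div,
    div_self (pow_ne_zero 2 h)]

@[simp]
theorem moebius_zero (z : Disk) : moebius z 0 = z := by
  ext
  simp [coe_moebius]

theorem expNegDist_zero (x : Disk) :
    expNegDist 0 x = (1 - ‖(x : ℂ)‖) / (1 + ‖(x : ℂ)‖) := by
  have : 0 < 1 + ‖(x : ℂ)‖ := by positivity
  simp only [expNegDist, Metric.unitBall.coe_zero, norm_zero, mul_zero, sub_zero, norm_one, zero_sub, norm_neg]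
  field_simp
  ring

theorem expNegDist_eq_zero_moebius (z x : Disk) : expNegDist z x = expNegDist 0 (moebius z x) := by
  have h := norm_one_sub_conj_mul_pos z x
  have hsymm : ‖1 - conj (x : ℂ) * z‖ = ‖1 - conj (z : ℂ) * x‖ := by
    rw [← RCLike.norm_conj]
    simp [mul_comm]
  rw [expNegDist_zero]
  unfold expNegDist
  rw [coe_moebius, norm_div, hsymm, ← mul_comm (1 - ‖(z : ℂ)‖ ^ 2), ← norm_sq_sub_norm_sq,
    norm_sub_rev (x : ℂ) z]
  have : 0 < ‖1 - conj (z : ℂ) * x‖ + ‖(z : ℂ) - x‖ := by positivity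
  field_simp
  ring

theorem psWeight_moebius (s : ℝ) (z x : Disk) : psWeight s z (moebius z x) = psWeight s 0 x := by
  rw [psWeight_eq, psWeight_eq, expNegDist_eq_zero_moebius, moebius_moebius]

end Disk

/-! ### Hyperbolic area -/

theorem measurable_diskDensity :
    Measurable fun z : ℂ => ENNReal.ofReal (1 / (1 - ‖z‖ ^ 2) ^ 2) := by
  fun_prop

theorem lintegral_diskVolume {G : ℂ → ℝ≥0∞} (hG : Measurable G) :
    ∫⁻ x : Disk, G x ∂diskVolume =
      ∫⁻ z in Metric.ball (0 : ℂ) 1, ENNReal.ofReal (1 / (1 - ‖z‖ ^ 2) ^ 2) * G z := by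
  unfold diskVolume
  rw [lintegral_withDensity_eq_lintegral_mul _
    (f := fun x : Disk => ENNReal.ofReal (1 / (1 - ‖(x : ℂ)‖ ^ 2) ^ 2)) (g := fun x : Disk => G x)
    (measurable_diskDensity.comp measurable_subtype_coe) (hG.comp measurable_subtype_coe)]
  exact lintegral_subtype_comap measurableSet_ball
    (fun z : ℂ => ENNReal.ofReal (1 / (1 - ‖z‖ ^ 2) ^ 2) * G z)

/-- The hyperbolic area is invariant under the Möbius involutions. -/
theorem lintegral_comp_moebius (z : Disk) {g : Disk → ℝ≥0∞} (hg : Measurable g) :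
    ∫⁻ x, g (Disk.moebius z x) ∂diskVolume = ∫⁻ x, g x ∂diskVolume := by
  have hemb : MeasurableEmbedding (Subtype.val : Disk → ℂ) :=
    MeasurableEmbedding.subtype_coe measurableSet_ball
  set G : ℂ → ℝ≥0∞ := Function.extend Subtype.val g 0 with hGdef
  have hG : Measurable G := hemb.measurable_extend hg measurable_zero
  have hGg : ∀ x : Disk, G x = g x := fun x => hemb.injective.extend_apply g 0 x
  set f : ℂ → ℂ := fun w => ((z : ℂ) - w) / (1 - conj (z : ℂ) * w) with hf
  have hfm : ∀ x : Disk, f x = Disk.moebius z x := fun x => rfl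
  have himage : f '' Metric.ball 0 1 = Metric.ball 0 1 := by
    ext y
    constructor
    · rintro ⟨x, hx, rfl⟩
      exact (Disk.moebius z ⟨x, hx⟩).2
    · intro hy
      exact ⟨Disk.moebius z ⟨y, hy⟩, (Disk.moebius z ⟨y, hy⟩).2, by
        rw [hfm, Disk.moebius_moebius]⟩
  have hinj : InjOn f (Metric.ball 0 1) := by
    intro x hx y hy hxy
    have h1 : Disk.moebius z ⟨x, hx⟩ = Disk.moebius z ⟨y, hy⟩ := Subtype.ext hxy
    have h2 := congrArg (Disk.moebius z) h1
    rw [Disk.moebius_moebius, Disk.moebius_moebius] at h2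
    exact congrArg Subtype.val h2
  set f' : ℂ → ℂ := fun w => (‖(z : ℂ)‖ ^ 2 - 1) / (1 - conj (z : ℂ) * w) ^ 2 with hf'
  have hderiv : ∀ w ∈ Metric.ball (0 : ℂ) 1, HasDerivAt f (f' w) w := by
    intro w hw
    have hne := Disk.one_sub_conj_mul_ne_zero z ⟨w, hw⟩
    have h1 : HasDerivAt (fun w => (z : ℂ) - w) (-1) w := by
      simpa using (hasDerivAt_id w).const_sub (z : ℂ)
    have h2 : HasDerivAt (fun w => 1 - conj (z : ℂ) * w) (-conj (z : ℂ)) w := by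
      simpa using ((hasDerivAt_id w).const_mul (conj (z : ℂ))).const_sub 1
    convert! h1.div h2 hne using 1
    simp only [hf']
    congr 1
    rw [← Complex.conj_mul']
    ring
  have hmeas : Measurable f := by
    simp only [hf]
    fun_prop
  have hleft : ∫⁻ x, g (Disk.moebius z x) ∂diskVolume = ∫⁻ x : Disk, G (f x) ∂diskVolume := by
    refine lintegral_congr fun x => ?_
    rw [hfm, hGg]
  have hright : ∫⁻ x, g x ∂diskVolume = ∫⁻ x : Disk, G x ∂diskVolume :=
    lintegral_congr fun x => (hGg x).symm
  rw [hleft, hright, lintegral_diskVolume hG, lintegral_diskVolume (G := fun w => G (f w)) (hG.comp hmeas)]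
  conv_rhs => rw [← himage]
  rw [lintegral_image_eq_lintegral_abs_det_fderiv_mul volume measurableSet_ball
    (fun w hw => (hderiv w hw).hasFDerivAt.restrictScalars ℝ |>.hasFDerivWithinAt) hinj]
  refine setLIntegral_congr_fun measurableSet_ball fun w hw => ?_
  have hdet : ((ContinuousLinearMap.toSpanSingleton ℂ (f' w)).restrictScalars ℝ).det
      = ‖f' w‖ ^ 2 := by
    simp [ContinuousLinearMap.det, LinearMap.det_restrictScalars,
      Algebra.norm_complex_eq, Complex.normSq_eq_norm_sq]
  rw [hdet, ← mul_assoc, ← ENNReal.ofReal_mul (abs_nonneg _), abs_of_nonneg (sq_nonneg _)]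
  congr 2
  have h1 := Disk.one_sub_norm_moebius_sq z ⟨w, hw⟩
  have h2 := Disk.norm_one_sub_conj_mul_pos z ⟨w, hw⟩
  have h3 := z.one_sub_norm_sq_pos
  have h4 := Disk.one_sub_norm_sq_pos ⟨w, hw⟩
  rw [← hfm] at h1
  simp only at h1 h2 h4
  have h5 : ‖f' w‖ = (1 - ‖(z : ℂ)‖ ^ 2) / ‖1 - conj (z : ℂ) * w‖ ^ 2 := by
    simp only [hf']
    rw [norm_div, norm_pow]
    congr 1
    rw [← Complex.ofReal_pow, ← Complex.ofReal_one, ← Complex.ofReal_sub, Complex.norm_real,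
      Real.norm_eq_abs, abs_sub_comm, abs_of_pos h3]
  rw [h1, h5]
  generalize 1 - ‖(z : ℂ)‖ ^ 2 = a at *
  generalize 1 - ‖w‖ ^ 2 = b at *
  field_simp

theorem circleAverage_eq_integral_neg_pi_pi (h : ℂ → ℝ) (r : ℝ) :
    Real.circleAverage h 0 r =
      (2 * Real.pi)⁻¹ * ∫ θ in Ioo (-Real.pi) Real.pi, h (circleMap 0 r θ) := by
  rw [Real.circleAverage_eq_integral_add (-Real.pi),
    intervalIntegral.integral_comp_add_right (fun θ => h (circleMap 0 r θ)),
    intervalIntegral.integral_of_le (by linarith [Real.pi_pos]), integral_Ioc_eq_integral_Ioo,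
    smul_eq_mul]
  congr 4 <;> ring

/-- Polar coordinates and the mean value property: a radial weight integrates a nonnegative
harmonic function to its value at the centre times the mass of the weight. -/
theorem lintegral_radial_mul_harmonic {ρ : ℝ → ℝ≥0∞} (hρ : Measurable ρ) {h : ℂ → ℝ}
    (hm : Measurable h) (hh : InnerProductSpace.HarmonicOnNhd h (Metric.ball 0 1))
    (hpos : ∀ z ∈ Metric.ball (0 : ℂ) 1, 0 ≤ h z) :
    ∫⁻ x : Disk, ρ ‖(x : ℂ)‖ * ENNReal.ofReal (h x) ∂diskVolume =
      ENNReal.ofReal (2 * Real.pi) *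
        (∫⁻ r in Ioo (0 : ℝ) 1, ENNReal.ofReal (r / (1 - r ^ 2) ^ 2) * ρ r) *
          ENNReal.ofReal (h 0) := by
  have hcm : ∀ r θ : ℝ, Complex.polarCoord.symm (r, θ) = circleMap 0 r θ := by
    intro r θ
    rw [Complex.polarCoord_symm_apply, circleMap_zero, Complex.exp_mul_I]
    push_cast
    rfl
  have hcmm : Measurable fun p : ℝ × ℝ => Complex.polarCoord.symm p := by
    have : (fun p : ℝ × ℝ => Complex.polarCoord.symm p) = fun p => circleMap 0 p.1 p.2 :=
      funext fun p => hcm p.1 p.2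
    rw [this]
    unfold circleMap
    fun_prop
  have hGm : Measurable fun z : ℂ => ρ ‖z‖ * ENNReal.ofReal (h z) := by fun_prop
  rw [lintegral_diskVolume hGm, ← lintegral_indicator measurableSet_ball,
    ← Complex.lintegral_comp_polarCoord_symm, polarCoord_target, Measure.volume_eq_prod,
    setLIntegral_prod]
  swap
  · refine (Measurable.smul (f := fun p : ℝ × ℝ => ENNReal.ofReal p.1) (by fun_prop)
      ?_).aemeasurable
    refine (Measurable.indicator ?_ measurableSet_ball).comp hcmm
    exact measurable_diskDensity.mul hGm
  have key : ∀ r ∈ Ioi (0 : ℝ),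
      (∫⁻ θ in Ioo (-Real.pi) Real.pi, ENNReal.ofReal (r, θ).1 •
        (Metric.ball (0 : ℂ) 1).indicator
          (fun z => ENNReal.ofReal (1 / (1 - ‖z‖ ^ 2) ^ 2) * (ρ ‖z‖ * ENNReal.ofReal (h z)))
          (Complex.polarCoord.symm (r, θ))) =
      (Ioo (0 : ℝ) 1).indicator (fun r => ENNReal.ofReal (2 * Real.pi) *
        (ENNReal.ofReal (r / (1 - r ^ 2) ^ 2) * ρ r) * ENNReal.ofReal (h 0)) r := by
    intro r hr
    have hr0 : 0 < r := hr
    by_cases hr1 : r < 1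
    · rw [indicator_of_mem (show r ∈ Ioo (0 : ℝ) 1 from ⟨hr0, hr1⟩)]
      have hmem : ∀ θ, circleMap 0 r θ ∈ Metric.ball (0 : ℂ) 1 := by
        intro θ
        rw [mem_ball_zero_iff, norm_circleMap_zero, abs_of_pos hr0]
        exact hr1
      have hcont : Continuous fun θ => h (circleMap 0 r θ) :=
        hh.continuousOn.comp_continuous (by fun_prop) hmem
      have hint : IntegrableOn (fun θ => h (circleMap 0 r θ)) (Ioo (-Real.pi) Real.pi) :=
        (hcont.integrableOn_Icc).mono_set Ioo_subset_Icc_self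
      have hmv : ∫ θ in Ioo (-Real.pi) Real.pi, h (circleMap 0 r θ) = 2 * Real.pi * h 0 := by
        have h1 : Real.circleAverage h 0 r = h 0 := by
          apply InnerProductSpace.HarmonicOnNhd.circleAverage_eq
          refine hh.mono (Metric.closedBall_subset_ball ?_)
          rwa [abs_of_pos hr0]
        rw [circleAverage_eq_integral_neg_pi_pi] at h1
        rw [← h1]
        field_simp
      have h2 : ∫⁻ θ in Ioo (-Real.pi) Real.pi, ENNReal.ofReal (h (circleMap 0 r θ)) =
          ENNReal.ofReal (2 * Real.pi * h 0) := by
        rw [← hmv, ofReal_integral_eq_lintegral_ofReal hint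
          (Eventually.of_forall fun θ => hpos _ (hmem θ))]
      calc _ = ∫⁻ θ in Ioo (-Real.pi) Real.pi,
            (ENNReal.ofReal (r / (1 - r ^ 2) ^ 2) * ρ r) *
              ENNReal.ofReal (h (circleMap 0 r θ)) := by
            refine lintegral_congr fun θ => ?_
            rw [hcm, indicator_of_mem (hmem θ), norm_circleMap_zero, abs_of_pos hr0, smul_eq_mul,
              div_eq_mul_one_div r, ENNReal.ofReal_mul hr0.le]
            ring
        _ = _ := by
            rw [lintegral_const_mul _ (by fun_prop), h2, ENNReal.ofReal_mul (by positivity)]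
            ring
    · rw [indicator_of_notMem (fun h => hr1 h.2)]
      have : ∀ θ, circleMap 0 r θ ∉ Metric.ball (0 : ℂ) 1 := by
        intro θ hθ
        rw [mem_ball_zero_iff, norm_circleMap_zero, abs_of_pos hr0] at hθ
        exact hr1 hθ
      simp [hcm, this]
  rw [setLIntegral_congr_fun measurableSet_Ioi key, setLIntegral_indicator measurableSet_Ioo,
    inter_eq_left.mpr (fun r hr => hr.1), lintegral_mul_const _ (by fun_prop),
    lintegral_const_mul _ (by fun_prop)]

/-- The hyperbolic integral `∫ e^{-s d(x, 0)} dμ(x)`, see `lintegral_psWeight_zero_mul_harmonic`. -/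
noncomputable def psMass (s : ℝ) : ℝ := Real.pi / (2 * (s ^ 2 - 1))

theorem psMass_pos {s : ℝ} (hs : 1 < s) : 0 < psMass s := by
  have : 0 < s ^ 2 - 1 := by nlinarith
  have := Real.pi_pos
  unfold psMass
  positivity

theorem lintegral_radial_rpow {s : ℝ} (hs : 1 < s) :
    ∫⁻ r in Ioo (0 : ℝ) 1, ENNReal.ofReal (r / (1 - r ^ 2) ^ 2) *
      ENNReal.ofReal (((1 - r) / (1 + r)) ^ s) = ENNReal.ofReal (1 / (4 * (s ^ 2 - 1))) := by
  have hs1 : s - 1 ≠ 0 := by linarith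
  have hs2 : s + 1 ≠ 0 := by linarith
  have hs3 : s ^ 2 - 1 ≠ 0 := by nlinarith
  set u : ℝ → ℝ := fun r => (1 - r) / (1 + r) with hu
  -- an antiderivative, found with the substitution `u = (1 - r) / (1 + r)`
  set F : ℝ → ℝ := fun r => (8 : ℝ)⁻¹ * (u r ^ (s + 1) / (s + 1) - u r ^ (s - 1) / (s - 1)) with hF
  set F' : ℝ → ℝ := fun r => r / (1 - r ^ 2) ^ 2 * u r ^ s with hF'
  have hucont : ContinuousOn u (Icc 0 1) := by
    refine ContinuousOn.div (by fun_prop) (by fun_prop) fun r hr => ?_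
    linarith [hr.1]
  have hFcont : ContinuousOn F (Icc 0 1) := by
    refine ContinuousOn.mul continuousOn_const (ContinuousOn.sub ?_ ?_)
    · exact (hucont.rpow_const fun r _ => Or.inr (by linarith)).div_const _
    · exact (hucont.rpow_const fun r _ => Or.inr (by linarith)).div_const _
  have hupos : ∀ r ∈ Ioo (0 : ℝ) 1, 0 < u r := fun r hr =>
    div_pos (by linarith [hr.2]) (by linarith [hr.1])
  have hderiv : ∀ r ∈ Ioo (0 : ℝ) 1, HasDerivAt F (F' r) r := by
    intro r hr
    have h1 : 1 + r ≠ 0 := by linarith [hr.1]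
    have h2 : 1 - r ≠ 0 := by linarith [hr.2]
    have hud : HasDerivAt u (-2 / (1 + r) ^ 2) r := by
      have ha : HasDerivAt (fun r : ℝ => 1 - r) (-1) r := by
        simpa using (hasDerivAt_id r).const_sub 1
      have hb : HasDerivAt (fun r : ℝ => 1 + r) 1 r := by
        simpa using (hasDerivAt_id r).const_add 1
      convert! ha.div hb h1 using 1
      ring
    have hA := (hud.rpow_const (p := s + 1) (Or.inl (hupos r hr).ne')).div_const (s + 1)
    have hB := (hud.rpow_const (p := s - 1) (Or.inl (hupos r hr).ne')).div_const (s - 1)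
    convert! (hA.sub hB).const_mul (8 : ℝ)⁻¹ using 1
    have e1 : u r ^ (s + 1 - 1) = u r ^ s := by congr 1; ring
    have e2 : u r ^ (s - 1 - 1) = u r ^ s / u r ^ 2 := by
      rw [← Real.rpow_two, ← Real.rpow_sub (hupos r hr)]; congr 1; ring
    rw [e1, e2]
    simp only [hF']
    generalize u r ^ s = U
    have h3 : 1 - r ^ 2 ≠ 0 := by
      have : 1 - r ^ 2 = (1 - r) * (1 + r) := by ring
      rw [this]; exact mul_ne_zero h2 h1
    simp only [hu]
    field_simp
    ring
  have hnonneg : ∀ r ∈ Ioo (0 : ℝ) 1, 0 ≤ F' r := fun r hr =>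
    mul_nonneg (div_nonneg hr.1.le (sq_nonneg _)) (Real.rpow_nonneg (hupos r hr).le _)
  have hint : IntegrableOn F' (Ioc 0 1) :=
    intervalIntegral.integrableOn_deriv_of_nonneg hFcont hderiv hnonneg
  have hval : ∫ r in Ioo (0 : ℝ) 1, F' r = 1 / (4 * (s ^ 2 - 1)) := by
    rw [← integral_Ioc_eq_integral_Ioo, ← intervalIntegral.integral_of_le zero_le_one,
      intervalIntegral.integral_eq_sub_of_hasDerivAt_of_le zero_le_one hFcont hderiv
        ((intervalIntegrable_iff_integrableOn_Ioc_of_le zero_le_one).mpr hint)]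
    simp only [hF, hu]
    norm_num [Real.zero_rpow hs1, Real.zero_rpow hs2]
    have : s ^ 2 - 1 = (s - 1) * (s + 1) := by ring
    rw [this]
    field_simp
    ring
  rw [← hval, ofReal_integral_eq_lintegral_ofReal (hint.mono_set Ioo_subset_Ioc_self)
    ((ae_restrict_iff' measurableSet_Ioo).mpr (Eventually.of_forall hnonneg))]
  refine setLIntegral_congr_fun measurableSet_Ioo fun r hr => ?_
  simp only [hF', hu]
  rw [ENNReal.ofReal_mul (div_nonneg hr.1.le (sq_nonneg _))]

theorem measurable_radialWeight (s : ℝ) :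
    Measurable fun r : ℝ => ENNReal.ofReal (((1 - r) / (1 + r)) ^ s) := by
  fun_prop

theorem ofReal_psWeight_zero (s : ℝ) (x : Disk) : ENNReal.ofReal (psWeight s 0 x) =
    ENNReal.ofReal (((1 - ‖(x : ℂ)‖) / (1 + ‖(x : ℂ)‖)) ^ s) := by
  rw [Disk.psWeight_eq, Disk.expNegDist_zero]

/-- The weight `e^{-s d(x, 0)}` integrates a nonnegative harmonic function to its value at the
centre, up to the factor `psMass s`. -/
theorem lintegral_psWeight_zero_mul_harmonic {s : ℝ} (hs : 1 < s) {h : ℂ → ℝ}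
    (hm : Measurable h) (hh : InnerProductSpace.HarmonicOnNhd h (Metric.ball 0 1))
    (hpos : ∀ z ∈ Metric.ball (0 : ℂ) 1, 0 ≤ h z) :
    ∫⁻ x : Disk, ENNReal.ofReal (psWeight s 0 x) * ENNReal.ofReal (h x) ∂diskVolume =
      ENNReal.ofReal (psMass s) * ENNReal.ofReal (h 0) := by
  simp only [ofReal_psWeight_zero]
  rw [lintegral_radial_mul_harmonic (measurable_radialWeight s) hm hh hpos,
    lintegral_radial_rpow hs, ← ENNReal.ofReal_mul (by positivity)]
  congr 2
  unfold psMass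
  have : s ^ 2 - 1 ≠ 0 := by nlinarith
  field_simp
  norm_num

instance : SFinite diskVolume := by
  have : SigmaFinite ((volume : Measure ℂ).comap (fun z : Disk => (z : ℂ))) := by
    refine SigmaFinite.of_map _ measurable_subtype_coe.aemeasurable ?_
    rw [(MeasurableEmbedding.subtype_coe measurableSet_ball).map_comap]
    infer_instance
  unfold diskVolume
  infer_instance

/-! ### The Poisson kernel -/

theorem poissonKernel_zero_circle (x : ℂ) (ζ : Circle) :
    poissonKernel 0 x ζ = (1 - ‖x‖ ^ 2) / ‖(ζ : ℂ) - x‖ ^ 2 := by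
  rw [poissonKernel_def, sub_zero, sub_zero, Circle.norm_coe, one_pow]

theorem norm_circle_sub_pos (x : Disk) (ζ : Circle) : 0 < ‖(ζ : ℂ) - x‖ := by
  rw [norm_pos_iff, sub_ne_zero]
  intro h
  have := x.norm_lt_one
  rw [← h, Circle.norm_coe] at this
  exact lt_irrefl _ this

theorem poissonKernel_circle_nonneg (x : Disk) (ζ : Circle) : 0 ≤ poissonKernel 0 (x : ℂ) ζ := by
  rw [poissonKernel_zero_circle]
  exact div_nonneg x.one_sub_norm_sq_pos.le (sq_nonneg _)

theorem poissonKernel_circle_le (x : Disk) (ζ : Circle) :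
    poissonKernel 0 (x : ℂ) ζ ≤ (Disk.expNegDist 0 x)⁻¹ := by
  have h1 := norm_circle_sub_pos x ζ
  have h2 := sub_pos.mpr x.norm_lt_one
  have h3 : 1 - ‖(x : ℂ)‖ ≤ ‖(ζ : ℂ) - x‖ := by
    have := norm_sub_norm_le (ζ : ℂ) x
    rwa [Circle.norm_coe] at this
  rw [poissonKernel_zero_circle, Disk.expNegDist_zero, inv_div, div_le_div_iff₀ (by positivity) h2]
  have h4 := pow_le_pow_left₀ h2.le h3 2
  nlinarith [norm_nonneg (x : ℂ)]

theorem continuous_poissonKernel_uncurry :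
    Continuous fun p : Disk × Circle => poissonKernel 0 (p.1 : ℂ) (p.2 : ℂ) := by
  simp only [poissonKernel_zero_circle]
  refine Continuous.div (by fun_prop) (by fun_prop) fun p => ?_
  exact pow_ne_zero _ (norm_circle_sub_pos p.1 p.2).ne'

theorem continuous_poissonKernel_left (ζ : Circle) :
    Continuous fun x : Disk => poissonKernel 0 (x : ℂ) (ζ : ℂ) :=
  continuous_poissonKernel_uncurry.comp (f := fun x => (x, ζ)) (by fun_prop)

theorem continuous_poissonKernel_right (x : Disk) :
    Continuous fun ζ : Circle => poissonKernel 0 (x : ℂ) (ζ : ℂ) :=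
  continuous_poissonKernel_uncurry.comp (f := fun ζ => (x, ζ)) (by fun_prop)

theorem integral_circleMeasure {E : Type*} [NormedAddCommGroup E] [NormedSpace ℝ E] {g : ℂ → E}
    (hg : Continuous fun ζ : Circle => g ζ) :
    ∫ ζ, g ζ ∂circleMeasure = Real.circleAverage g 0 1 := by
  unfold circleMeasure
  rw [integral_smul_measure, integral_map (by fun_prop) hg.aestronglyMeasurable,
    Real.circleAverage_def, intervalIntegral.integral_of_le Real.two_pi_pos.le]
  rw [ENNReal.toReal_inv, ENNReal.toReal_ofReal Real.two_pi_pos.le]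
  simp [circleMap]

theorem integrable_circleMeasure {E : Type*} [NormedAddCommGroup E] {g : Circle → E}
    (hg : Continuous g) : Integrable g circleMeasure :=
  hg.integrable_of_hasCompactSupport (HasCompactSupport.of_compactSpace g)

theorem lintegral_poissonKernel (x : Disk) :
    ∫⁻ ζ : Circle, ENNReal.ofReal (poissonKernel 0 (x : ℂ) ζ) ∂circleMeasure = 1 := by
  have hc := continuous_poissonKernel_right x
  rw [← ofReal_integral_eq_lintegral_ofReal (integrable_circleMeasure hc)
    (Eventually.of_forall (poissonKernel_circle_nonneg x)),
    integral_circleMeasure (g := poissonKernel 0 (x : ℂ)) hc]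
  have := InnerProductSpace.HarmonicOnNhd.circleAverage_poissonKernel_smul (f := fun _ => (1 : ℝ))
    (InnerProductSpace.harmonicOnNhd_const 1) x.2
  rw [show poissonKernel 0 (x : ℂ) • (fun _ => (1 : ℝ)) = poissonKernel 0 (x : ℂ) from by
    ext; simp] at this
  rw [this, ENNReal.ofReal_one]

/-- The mean value property of the weights: `∫ e^{-s d(x, z)} P_x(ζ) dμ(x)` is `P_z(ζ)` up to the
factor `psMass s`. -/
theorem lintegral_psWeight_mul_poissonKernel {s : ℝ} (hs : 1 < s) (z : Disk) (ζ : Circle) :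
    ∫⁻ x : Disk, ENNReal.ofReal (psWeight s z x * poissonKernel 0 (x : ℂ) ζ) ∂diskVolume =
      ENNReal.ofReal (psMass s * poissonKernel 0 (z : ℂ) ζ) := by
  have hm : Measurable fun x : Disk =>
      ENNReal.ofReal (psWeight s z x * poissonKernel 0 (x : ℂ) ζ) :=
    ((Disk.continuous_psWeight s z).mul (continuous_poissonKernel_left ζ)).measurable.ennreal_ofReal
  -- move the base point to the centre
  rw [← lintegral_comp_moebius z hm]
  simp only [Disk.psWeight_moebius]
  set φ : ℂ → ℂ := fun w => ((z : ℂ) - w) / (1 - conj (z : ℂ) * w) with hφ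
  set h : ℂ → ℝ := fun w => (((ζ : ℂ) + φ w) / ((ζ : ℂ) - φ w)).re with hh
  have hφmem : ∀ w ∈ Metric.ball (0 : ℂ) 1, φ w ∈ Metric.ball (0 : ℂ) 1 := fun w hw =>
    (Disk.moebius z ⟨w, hw⟩).2
  have hker : ∀ w : Disk, h w = poissonKernel 0 (Disk.moebius z w : ℂ) ζ := by
    intro w
    rw [poissonKernel_eq_re_herglotzRieszKernel, Function.comp_apply, herglotzRieszKernel_def]
    simp only [hh, sub_zero]
    rfl
  have hdiff : DifferentiableOn ℂ (fun w => ((ζ : ℂ) + φ w) / ((ζ : ℂ) - φ w))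
      (Metric.ball 0 1) := by
    have hφd : DifferentiableOn ℂ φ (Metric.ball 0 1) := by
      refine DifferentiableOn.div (by fun_prop) (by fun_prop) fun w hw => ?_
      exact Disk.one_sub_conj_mul_ne_zero z ⟨w, hw⟩
    refine DifferentiableOn.div (hφd.const_add _) (hφd.const_sub _) fun w hw => ?_
    exact norm_pos_iff.mp (norm_circle_sub_pos ⟨φ w, hφmem w hw⟩ ζ)
  have hharm : InnerProductSpace.HarmonicOnNhd h (Metric.ball 0 1) := fun w hw =>
    (hdiff.analyticAt (Metric.isOpen_ball.mem_nhds hw)).harmonicAt_re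
  have hhm : Measurable h := by
    simp only [hh, hφ]
    fun_prop
  have hpos : ∀ w ∈ Metric.ball (0 : ℂ) 1, 0 ≤ h w := fun w hw => by
    rw [show h w = h (⟨w, hw⟩ : Disk) from rfl, hker]
    exact poissonKernel_circle_nonneg _ _
  have h0 : h 0 = poissonKernel 0 (z : ℂ) ζ := by
    have := hker 0
    rwa [Disk.moebius_zero] at this
  rw [ENNReal.ofReal_mul (psMass_pos hs).le, ← h0,
    ← lintegral_psWeight_zero_mul_harmonic hs hhm hharm hpos]
  refine lintegral_congr fun x => ?_
  rw [ENNReal.ofReal_mul (Disk.psWeight_pos _ _ _).le, hker]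

/-- The weights beat the growth of the Poisson kernel, since `P_x(ζ) ≤ e^{d(x, 0)}`. -/
theorem psWeight_mul_poissonKernel_le {s : ℝ} (hs : 1 ≤ s) (z x : Disk) (ζ : Circle) :
    psWeight s z x * poissonKernel 0 (x : ℂ) ζ ≤ Disk.harnackConst z 0 ^ s := by
  have he := Disk.expNegDist_pos 0 x
  have h1 := Disk.psWeight_le_harnackConst_mul (by linarith : 0 ≤ s) z 0 x
  have hK := Real.rpow_nonneg (Disk.harnackConst_pos z 0).le s
  have h2 : psWeight s 0 x ≤ Disk.expNegDist 0 x := by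
    rw [Disk.psWeight_eq]
    simpa using Real.rpow_le_rpow_of_exponent_ge he (Disk.expNegDist_le_one 0 x) hs
  calc psWeight s z x * poissonKernel 0 (x : ℂ) ζ
      ≤ (Disk.harnackConst z 0 ^ s * Disk.expNegDist 0 x) * (Disk.expNegDist 0 x)⁻¹ :=
        mul_le_mul (h1.trans (mul_le_mul_of_nonneg_left h2 hK)) (poissonKernel_circle_le x ζ)
          (poissonKernel_circle_nonneg x ζ) (by positivity)
    _ = Disk.harnackConst z 0 ^ s := by field_simp

/-! ### Sums over the points of a configuration -/

namespace Conf

variable {E : Type*} [TopologicalSpace E]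

theorem finite_point_mem (X : Conf E) {K : Set E} (hK : IsCompact K) :
    {p : X.Point | p.1 ∈ K}.Finite := by
  refine ((X.locallyFinite K hK).toFinset.sigma fun _ => Finset.univ).finite_toSet.subset
    fun p hp => ?_
  have h0 : X.mult p.1 ≠ 0 := (Fin.pos p.2).ne'
  simpa [h0] using hp

instance countable_point [SigmaCompactSpace E] (X : Conf E) : Countable X.Point := by
  rw [← countable_univ_iff]
  have : (univ : Set X.Point) = ⋃ n, {p : X.Point | p.1 ∈ compactCovering E n} := by
    refine (eq_univ_of_forall fun p => ?_).symm
    exact mem_iUnion.mpr (exists_mem_compactCovering p.1)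
  rw [this]
  exact countable_iUnion fun n => (X.finite_point_mem (isCompact_compactCovering E n)).countable

theorem tsum_point_iSup (X : Conf E) {f : ℕ → E → ℝ≥0∞} (hf : Monotone f) :
    ∑' p : X.Point, ⨆ n, f n p.1 = ⨆ n, ∑' p : X.Point, f n p.1 := by
  simp only [ENNReal.tsum_eq_iSup_sum]
  rw [iSup_comm]
  refine iSup_congr fun s => ?_
  exact ENNReal.finsetSum_iSup_of_monotone fun p m n hmn => hf hmn p.1

theorem tsum_indicator_const (c : ℝ≥0∞) (B : Set E) (X : Conf E) :
    ∑' p : X.Point, B.indicator (fun _ => c) p.1 = c * count B X := by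
  unfold count
  rw [← ENNReal.tsum_mul_left]
  refine tsum_congr fun p => ?_
  by_cases h : p.1 ∈ B <;> simp [h]

section SigmaCompact

variable [SigmaCompactSpace E]

theorem iSup_indicator_compactCovering (g : E → ℝ≥0∞) (x : E) :
    ⨆ n, (compactCovering E n).indicator g x = g x := by
  refine le_antisymm (iSup_le fun n => indicator_le_self _ _ _) ?_
  obtain ⟨n, hn⟩ := exists_mem_compactCovering x
  exact le_iSup_of_le n (by rw [indicator_of_mem hn])

theorem monotone_indicator_compactCovering (g : E → ℝ≥0∞) :
    Monotone fun n => (compactCovering E n).indicator g := fun _ _ hmn =>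
  indicator_le_indicator_of_subset (compactCovering_subset E hmn) fun _ => zero_le

variable [MeasurableSpace E] [T2Space E] [OpensMeasurableSpace E]

theorem measurable_count {B : Set E} (hB : MeasurableSet B) : Measurable (count B) := by
  have hrel : ∀ n, Measurable (count (compactCovering E n ∩ B)) := by
    intro n
    rw [measurable_iff_comap_le]
    refine le_iSup_of_le _ (le_iSup_of_le ?_ (le_iSup_of_le ?_ le_rfl))
    · exact (isCompact_compactCovering E n).isClosed.measurableSet.inter hB
    · exact ⟨_, isCompact_compactCovering E n, inter_subset_left⟩
  have heq : (count B : Conf E → ℝ≥0∞) = fun X => ⨆ n, count (compactCovering E n ∩ B) X := by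
    funext X
    unfold count
    simp only [← indicator_indicator]
    rw [← tsum_point_iSup X (monotone_indicator_compactCovering _)]
    simp only [iSup_indicator_compactCovering]
  rw [heq]
  exact Measurable.iSup hrel

/-- Campbell's formula, together with the measurability that it presupposes. -/
theorem measurable_tsum_and_lintegral_tsum {g : E → ℝ≥0∞} (hg : Measurable g) :
    (Measurable fun X : Conf E => ∑' p : X.Point, g p.1) ∧
      ∀ (P : Measure (Conf E)) (ξ : Measure E), HasFirstIntensity P ξ →
        ∫⁻ X, ∑' p : X.Point, g p.1 ∂P = ∫⁻ x, g x ∂ξ := by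
  refine Measurable.ennreal_induction ?_ ?_ ?_ hg
  · intro c B hB
    simp only [tsum_indicator_const]
    refine ⟨(measurable_count hB).const_mul c, fun P ξ h => ?_⟩
    rw [lintegral_const_mul _ (measurable_count hB), h B hB, lintegral_indicator_const hB]
  · intro f g _ hf hg hfm hgm
    simp only [Pi.add_apply, ENNReal.tsum_add]
    refine ⟨hfm.1.add hgm.1, fun P ξ h => ?_⟩
    rw [lintegral_add_left hfm.1, lintegral_add_left hf, hfm.2 P ξ h, hgm.2 P ξ h]
  · intro f hf hmono ih
    simp only [fun X : Conf E => tsum_point_iSup X hmono]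
    refine ⟨Measurable.iSup fun n => (ih n).1, fun P ξ h => ?_⟩
    rw [lintegral_iSup (fun n => (ih n).1)
      fun m n hmn X => ENNReal.tsum_le_tsum fun p => hmono hmn p.1]
    simp only [(ih _).2 P ξ h]
    rw [lintegral_iSup hf hmono]

theorem measurable_tsum {g : E → ℝ≥0∞} (hg : Measurable g) :
    Measurable fun X : Conf E => ∑' p : X.Point, g p.1 :=
  (measurable_tsum_and_lintegral_tsum hg).1

theorem _root_.HasFirstIntensity.lintegral_tsum {P : Measure (Conf E)} {ξ : Measure E}
    (h : HasFirstIntensity P ξ) {g : E → ℝ≥0∞} (hg : Measurable g) :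
    ∫⁻ X, ∑' p : X.Point, g p.1 ∂P = ∫⁻ x, g x ∂ξ :=
  (measurable_tsum_and_lintegral_tsum hg).2 P ξ h

/-- A linear statistic is jointly measurable in the configuration and a parameter on which the test
function depends continuously: up to truncation to compact sets, it is a finite sum. -/
theorem measurable_tsum_uncurry {Z : Type*} [TopologicalSpace Z] [TopologicalSpace.MetrizableSpace Z]
    [MeasurableSpace Z] [SecondCountableTopology Z] [OpensMeasurableSpace Z] {u : Z → E → ℝ≥0∞}
    (hcont : ∀ x, Continuous fun ζ => u ζ x) (hmeas : ∀ ζ, Measurable (u ζ)) :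
    Measurable (Function.uncurry fun (ζ : Z) (X : Conf E) => ∑' p : X.Point, u ζ p.1) := by
  have heq : (Function.uncurry fun (ζ : Z) (X : Conf E) => ∑' p : X.Point, u ζ p.1) =
      fun q => ⨆ n, Function.uncurry (fun (ζ : Z) (X : Conf E) =>
        ∑' p : X.Point, (compactCovering E n).indicator (u ζ) p.1) q := by
    funext ⟨ζ, X⟩
    simp only [Function.uncurry_apply_pair]
    rw [← tsum_point_iSup X (monotone_indicator_compactCovering _)]
    simp only [iSup_indicator_compactCovering]
  rw [heq]
  refine Measurable.iSup fun n => measurable_uncurry_of_continuous_of_measurable ?_ ?_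
  · intro X
    have hfin := X.finite_point_mem (isCompact_compactCovering E n)
    have hsum : ∀ ζ, ∑' p : X.Point, (compactCovering E n).indicator (u ζ) p.1 =
        ∑ p ∈ hfin.toFinset, u ζ p.1 := by
      intro ζ
      rw [tsum_eq_sum (s := hfin.toFinset)]
      · refine Finset.sum_congr rfl fun p hp => indicator_of_mem ?_ _
        simpa using hp
      · intro p hp
        exact indicator_of_notMem (by simpa using hp) _
    simp only [hsum]
    exact continuous_finsetSum _ fun p _ => hcont p.1
  · exact fun ζ => measurable_tsum ((hmeas ζ).indicator
      (isCompact_compactCovering E n).isClosed.measurableSet)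

end SigmaCompact

end Conf

instance : LocallyCompactSpace Disk := Metric.isOpen_ball.locallyCompactSpace

/-! ### Unconditional convergence in `L²` -/

section LpTwo

variable {α E : Type*} [MeasurableSpace α] {μ : Measure α} [NormedAddCommGroup E]

theorem eLpNorm_two_sq (f : α → E) : eLpNorm f 2 μ ^ 2 = ∫⁻ x, ‖f x‖ₑ ^ 2 ∂μ := by
  have := eLpNorm_nnreal_pow_eq_lintegral (f := f) (μ := μ) (p := 2) two_ne_zero
  rw [NNReal.coe_ofNat, ENNReal.rpow_two] at this
  simpa only [ENNReal.rpow_two, ENNReal.coe_ofNat] using this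

/-- A series in `L²` converges unconditionally if it does so pointwise and its finite partial sums
are dominated by the pointwise sum, as is the case for nonnegative terms. -/
theorem hasSum_toLp_of_dominated {ι : Type*} [Countable ι] {f : ι → Lp E 2 μ} {G : α → E}
    (hG : MemLp G 2 μ) (hsum : ∀ᵐ x ∂μ, HasSum (fun i => f i x) (G x))
    (hbound : ∀ᵐ x ∂μ, ∀ s : Finset ι, ‖∑ i ∈ s, f i x‖ ≤ ‖G x‖) : HasSum f (hG.toLp G) := by
  rw [HasSum, SummationFilter.unconditional_filter, Lp.tendsto_Lp_iff_tendsto_eLpNorm]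
  have hcoe : ∀ s : Finset ι, ⇑(∑ i ∈ s, f i) =ᵐ[μ] fun x => ∑ i ∈ s, f i x := by
    intro s
    refine (Lp.coeFn_finsetSum s f).trans (Eventually.of_forall fun x => ?_)
    simp
  have hlim : Tendsto (fun s : Finset ι => ∫⁻ x, ‖∑ i ∈ s, f i x - G x‖ₑ ^ 2 ∂μ) atTop (𝓝 0) := by
    have h0 : (0 : ℝ≥0∞) = ∫⁻ _, 0 ∂μ := by simp
    rw [h0]
    refine tendsto_lintegral_filter_of_dominated_convergence' (fun x => (2 * ‖G x‖ₑ) ^ 2)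
      (Eventually.of_forall fun s => ?_) (Eventually.of_forall fun s => ?_) ?_ ?_
    · refine AEMeasurable.pow_const ?_ 2
      refine AEStronglyMeasurable.enorm ?_
      exact ((Lp.aestronglyMeasurable _).congr (hcoe s)).sub hG.aestronglyMeasurable
    · filter_upwards [hbound] with x hx
      gcongr
      refine (enorm_sub_le (a := ∑ i ∈ s, f i x) (b := G x)).trans ?_
      rw [two_mul]
      gcongr
      exact enorm_le_iff_norm_le.mpr (hx s)
    · simp only [mul_pow]
      rw [lintegral_const_mul'' _ (hG.aestronglyMeasurable.enorm.pow_const 2), ← eLpNorm_two_sq]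
      exact ENNReal.mul_ne_top (by simp) (ENNReal.pow_ne_top hG.eLpNorm_ne_top)
    · filter_upwards [hsum] with x hx
      have h1 : Tendsto (fun s : Finset ι => ∑ i ∈ s, f i x - G x) atTop (𝓝 0) := by
        simpa using (show Tendsto _ atTop _ from hx).sub_const (G x)
      have h2 := (ENNReal.continuous_pow 2).tendsto _ |>.comp (continuous_enorm.tendsto _ |>.comp h1)
      simpa [Function.comp_def] using h2
  have hsqrt : Tendsto (fun s : Finset ι => (eLpNorm (⇑(∑ i ∈ s, f i) - G) 2 μ ^ 2) ^ (2⁻¹ : ℝ))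
      atTop (𝓝 (0 ^ (2⁻¹ : ℝ))) := by
    refine (ENNReal.continuous_rpow_const.tendsto 0).comp (hlim.congr fun s => ?_)
    rw [eLpNorm_two_sq]
    refine lintegral_congr_ae ?_
    filter_upwards [hcoe s] with x hx
    rw [Pi.sub_apply, hx]
  rw [ENNReal.zero_rpow_of_pos (by norm_num)] at hsqrt
  refine hsqrt.congr fun s => ?_
  rw [← ENNReal.rpow_natCast, ← ENNReal.rpow_mul]
  simp

end LpTwo

/-! ### Moments of the Poisson series -/

/-- The series `∑_{x ∈ X} e^{-s d(x, z)} P_x(ζ)`, a sum of nonnegative terms that may diverge. -/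
noncomputable def poissonSeries (s : ℝ) (z : Disk) (ζ : Circle) (X : Conf Disk) : ℝ≥0∞ :=
  ∑' p : X.Point, ENNReal.ofReal (psWeight s z p.1 * poissonKernel 0 (p.1 : ℂ) ζ)

theorem continuous_psWeight_mul_poissonKernel_left (s : ℝ) (z : Disk) (ζ : Circle) :
    Continuous fun x : Disk => psWeight s z x * poissonKernel 0 (x : ℂ) ζ :=
  (Disk.continuous_psWeight s z).mul (continuous_poissonKernel_left ζ)

theorem psWeight_mul_poissonKernel_nonneg (s : ℝ) (z x : Disk) (ζ : Circle) :
    0 ≤ psWeight s z x * poissonKernel 0 (x : ℂ) ζ :=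
  mul_nonneg (Disk.psWeight_pos s z x).le (poissonKernel_circle_nonneg x ζ)

theorem measurable_poissonSeries_uncurry (s : ℝ) (z : Disk) :
    Measurable (Function.uncurry (poissonSeries s z)) := by
  unfold poissonSeries
  refine Conf.measurable_tsum_uncurry
    (u := fun (ζ : Circle) (x : Disk) => ENNReal.ofReal (psWeight s z x * poissonKernel 0 (x : ℂ) ζ)) ?_ ?_
  · intro x
    exact ENNReal.continuous_ofReal.comp (continuous_const.mul (continuous_poissonKernel_right x))
  · exact fun ζ =>
      (continuous_psWeight_mul_poissonKernel_left s z ζ).measurable.ennreal_ofReal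

theorem measurable_enorm_poissonSeries_sub_sq (s : ℝ) (z : Disk) (a : ℝ) :
    Measurable fun q : Circle × Conf Disk => ‖((poissonSeries s z q.1 q.2).toReal : ℂ) -
      (a * poissonKernel 0 (z : ℂ) q.1 : ℝ)‖ₑ ^ 2 := by
  refine Measurable.pow_const (Measurable.enorm (Measurable.sub ?_ ?_)) 2
  · exact Complex.measurable_ofReal.comp (measurable_poissonSeries_uncurry s z).ennreal_toReal
  · exact Complex.measurable_ofReal.comp (measurable_const.mul
      ((continuous_poissonKernel_right z).measurable.comp measurable_fst))

theorem measurable_poissonSeries (s : ℝ) (z : Disk) (ζ : Circle) :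
    Measurable (poissonSeries s z ζ) :=
  (measurable_poissonSeries_uncurry s z).comp measurable_prodMk_left

/-- The variance bound `HasVarianceBound` for a given constant `C`. -/
def HasVarianceBoundWith (P : Measure (Conf Disk)) (C : ℝ≥0) : Prop :=
  ∀ f : Disk → ℂ, Measurable f →
    ∫⁻ X, ∑' p : X.Point, (‖f p.1‖ₑ + ‖f p.1‖ₑ ^ 2) ∂P < ∞ →
      complexVariance (fun X : Conf Disk => ∑' p : X.Point, f p.1) P
        ≤ C * ∫⁻ X, ∑' p : X.Point, ‖f p.1‖ₑ ^ 2 ∂P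

section Moments

variable {P : Measure (Conf Disk)} {lam : ℝ}

theorem lintegral_poissonSeries (hlam : 0 < lam)
    (hint : HasFirstIntensity P (ENNReal.ofReal lam • diskVolume)) {s : ℝ} (hs : 1 < s) (z : Disk)
    (ζ : Circle) :
    ∫⁻ X, poissonSeries s z ζ X ∂P =
      ENNReal.ofReal (lam * psMass s * poissonKernel 0 (z : ℂ) ζ) := by
  unfold poissonSeries
  rw [hint.lintegral_tsum
      (continuous_psWeight_mul_poissonKernel_left s z ζ).measurable.ennreal_ofReal,
    lintegral_smul_measure, lintegral_psWeight_mul_poissonKernel hs, smul_eq_mul,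
    ← ENNReal.ofReal_mul hlam.le, mul_assoc]

/-- The variance bound at a point `ζ` of the circle. The second moment of the weighted Poisson
kernel is controlled by its first moment, because the weighted kernel is bounded. -/
theorem lintegral_poissonSeries_sub_sq_le (hlam : 0 < lam)
    (hint : HasFirstIntensity P (ENNReal.ofReal lam • diskVolume)) {C : ℝ≥0}
    (hC : HasVarianceBoundWith P C)
    {s : ℝ} (hs : 1 < s) (z : Disk) (ζ : Circle) :
    ∫⁻ X, ‖((poissonSeries s z ζ X).toReal : ℂ) -
        (lam * psMass s * poissonKernel 0 (z : ℂ) ζ : ℝ)‖ₑ ^ 2 ∂P ≤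
      C * (ENNReal.ofReal (Disk.harnackConst z 0 ^ s) *
        ENNReal.ofReal (lam * psMass s * poissonKernel 0 (z : ℂ) ζ)) := by
  set g : Disk → ℝ := fun x => psWeight s z x * poissonKernel 0 (x : ℂ) ζ with hg
  set f : Disk → ℂ := fun x => (g x : ℂ) with hf
  set m : ℝ := lam * psMass s * poissonKernel 0 (z : ℂ) ζ with hm
  have hm0 : 0 ≤ m := mul_nonneg (mul_pos hlam (psMass_pos hs)).le (poissonKernel_circle_nonneg z ζ)
  have hg0 : ∀ x, 0 ≤ g x := fun x => psWeight_mul_poissonKernel_nonneg s z x ζ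
  have hgm : Measurable g := (continuous_psWeight_mul_poissonKernel_left s z ζ).measurable
  have hfm : Measurable f := Complex.measurable_ofReal.comp hgm
  have hfn : ∀ x, ‖f x‖ₑ = ENNReal.ofReal (g x) := fun x => by
    rw [← ofReal_norm, Complex.norm_real, Real.norm_of_nonneg (hg0 x)]
  have hfirst : ∫⁻ X, ∑' p : X.Point, ‖f p.1‖ₑ ∂P = ENNReal.ofReal m := by
    simp only [hfn]
    exact lintegral_poissonSeries hlam hint hs z ζ
  have hsecond : ∫⁻ X, ∑' p : X.Point, ‖f p.1‖ₑ ^ 2 ∂P ≤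
      ENNReal.ofReal (Disk.harnackConst z 0 ^ s) * ENNReal.ofReal m := by
    rw [← hfirst, ← lintegral_const_mul _ (Conf.measurable_tsum hfm.enorm)]
    refine lintegral_mono fun X => ?_
    dsimp only
    rw [← ENNReal.tsum_mul_left]
    refine ENNReal.tsum_le_tsum fun p => ?_
    rw [sq]
    gcongr
    rw [hfn]
    exact ENNReal.ofReal_le_ofReal (psWeight_mul_poissonKernel_le hs.le z p.1 ζ)
  have hfin : ∫⁻ X, ∑' p : X.Point, (‖f p.1‖ₑ + ‖f p.1‖ₑ ^ 2) ∂P < ∞ := by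
    simp only [ENNReal.tsum_add]
    rw [lintegral_add_left (Conf.measurable_tsum hfm.enorm), hfirst]
    exact ENNReal.add_lt_top.mpr ⟨ENNReal.ofReal_lt_top, hsecond.trans_lt
      (ENNReal.mul_lt_top ENNReal.ofReal_lt_top ENNReal.ofReal_lt_top)⟩
  -- where the series diverges, both sides take the junk value `0`
  have hS : ∀ X : Conf Disk,
      ∑' p : X.Point, f p.1 = ((poissonSeries s z ζ X).toReal : ℂ) := by
    intro X
    simp only [hf, poissonSeries]
    rw [← Complex.ofReal_tsum, ENNReal.tsum_toReal_eq fun p => ENNReal.ofReal_ne_top]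
    congr 1
    exact tsum_congr fun p => (ENNReal.toReal_ofReal (hg0 p.1)).symm
  have hlint := lintegral_poissonSeries hlam hint hs z ζ
  have hmean : ∫ X, ((poissonSeries s z ζ X).toReal : ℂ) ∂P = (m : ℂ) := by
    rw [integral_complex_ofReal, integral_toReal (measurable_poissonSeries s z ζ).aemeasurable
      (ae_lt_top (measurable_poissonSeries s z ζ) (by rw [hlint]; exact ENNReal.ofReal_ne_top)),
      hlint, ENNReal.toReal_ofReal hm0]
  have hvar := hC f hfm hfin
  simp only [complexVariance, hS, hmean] at hvar
  exact hvar.trans (by gcongr)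

/-- The mean square distance in `L²(𝕋)` from the Poisson series to its expectation. -/
theorem lintegral_lintegral_poissonSeries_sub_sq_le [SFinite P] (hlam : 0 < lam)
    (hint : HasFirstIntensity P (ENNReal.ofReal lam • diskVolume)) {C : ℝ≥0}
    (hC : HasVarianceBoundWith P C)
    {s : ℝ} (hs : 1 < s) (z : Disk) :
    ∫⁻ X, ∫⁻ ζ, ‖((poissonSeries s z ζ X).toReal : ℂ) -
        (lam * psMass s * poissonKernel 0 (z : ℂ) ζ : ℝ)‖ₑ ^ 2 ∂circleMeasure ∂P ≤
      ENNReal.ofReal (C * Disk.harnackConst z 0 ^ s * (lam * psMass s)) := by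
  have hK := Real.rpow_nonneg (Disk.harnackConst_pos z 0).le s
  have hM := (mul_pos hlam (psMass_pos hs)).le
  rw [← lintegral_lintegral_swap
    (measurable_enorm_poissonSeries_sub_sq s z (lam * psMass s)).aemeasurable]
  refine (lintegral_mono fun ζ => lintegral_poissonSeries_sub_sq_le hlam hint hC hs z ζ).trans ?_
  simp only [ENNReal.ofReal_mul (p := lam * psMass s) hM, ← mul_assoc]
  rw [lintegral_const_mul _ (continuous_poissonKernel_right z).measurable.ennreal_ofReal,
    lintegral_poissonKernel, mul_one, 
    mul_assoc (C * Disk.harnackConst z 0 ^ s) lam,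
    ENNReal.ofReal_mul (p := C * Disk.harnackConst z 0 ^ s) (by positivity),
    ENNReal.ofReal_mul (p := (C : ℝ)) C.coe_nonneg, ENNReal.ofReal_coe_nnreal]

theorem ae_ae_poissonSeries_lt_top [SFinite P] (hlam : 0 < lam)
    (hint : HasFirstIntensity P (ENNReal.ofReal lam • diskVolume)) {s : ℝ} (hs : 1 < s)
    (z : Disk) : ∀ᵐ X ∂P, ∀ᵐ ζ ∂circleMeasure, poissonSeries s z ζ X < ∞ := by
  have hset : MeasurableSet {q : Circle × Conf Disk | poissonSeries s z q.1 q.2 < ∞} :=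
    measurableSet_lt (measurable_poissonSeries_uncurry s z) measurable_const
  refine (Measure.ae_ae_comm (p := fun ζ X => poissonSeries s z ζ X < ∞) hset).mp ?_
  refine Eventually.of_forall fun ζ => ae_lt_top (measurable_poissonSeries s z ζ) ?_
  rw [lintegral_poissonSeries hlam hint hs z ζ]
  exact ENNReal.ofReal_ne_top

end Moments

theorem coeFn_poissonL2 (x : Disk) :
    ⇑(poissonL2 x) =ᵐ[circleMeasure] fun ζ => ((poissonKernel 0 (x : ℂ) ζ : ℝ) : ℂ) :=
  ContinuousMap.coeFn_toLp circleMeasure (poissonC x)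

/-- If the pointwise Poisson series of a configuration is at finite `L²` distance from a multiple of
`P_z`, then it converges unconditionally in `L²(𝕋)`, with the same distance to that multiple. -/
theorem summable_poissonL2_of_lintegral_lt_top {X : Conf Disk} {s : ℝ} {z : Disk} (a : ℝ)
    (hfin : ∀ᵐ ζ ∂circleMeasure, poissonSeries s z ζ X < ∞)
    (hsq : ∫⁻ ζ, ‖((poissonSeries s z ζ X).toReal : ℂ) -
        (a * poissonKernel 0 (z : ℂ) ζ : ℝ)‖ₑ ^ 2 ∂circleMeasure < ∞) :
    (Summable fun p : X.Point => psWeight s z p.1 • poissonL2 p.1) ∧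
      ‖(∑' p : X.Point, psWeight s z p.1 • poissonL2 p.1) - a • poissonL2 z‖ₑ ^ 2 =
        ∫⁻ ζ, ‖((poissonSeries s z ζ X).toReal : ℂ) -
          (a * poissonKernel 0 (z : ℂ) ζ : ℝ)‖ₑ ^ 2 ∂circleMeasure := by
  set G : Circle → ℂ := fun ζ => ((poissonSeries s z ζ X).toReal : ℂ) with hGdef
  set Q : Circle → ℂ := fun ζ => ((a * poissonKernel 0 (z : ℂ) ζ : ℝ) : ℂ) with hQdef
  have hGm : Measurable G := Complex.measurable_ofReal.comp
    ((measurable_poissonSeries_uncurry s z).comp measurable_prodMk_right).ennreal_toReal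
  have hQc : Continuous Q := Complex.continuous_ofReal.comp
    (continuous_const.mul (continuous_poissonKernel_right z))
  have hQ : MemLp Q 2 circleMeasure := by
    have := Lp.memLp (a • poissonL2 z)
    refine this.ae_eq ?_
    filter_upwards [Lp.coeFn_smul a (poissonL2 z), coeFn_poissonL2 z] with ζ h1 h2
    simp [h1, h2, hQdef]
  have hGQ : MemLp (G - Q) 2 circleMeasure := by
    refine ⟨(hGm.sub hQc.measurable).aestronglyMeasurable, ?_⟩
    have : eLpNorm (G - Q) 2 circleMeasure ^ 2 < ∞ := by
      rw [eLpNorm_two_sq]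
      exact hsq
    exact (ENNReal.pow_lt_top_iff.mp this).resolve_right two_ne_zero
  have hG : MemLp G 2 circleMeasure := by simpa using hGQ.add hQ
  have hcoe : ∀ᵐ ζ ∂circleMeasure, ∀ p : X.Point, (psWeight s z p.1 • poissonL2 p.1 : Lp ℂ 2 _) ζ =
      ((psWeight s z p.1 * poissonKernel 0 (p.1 : ℂ) ζ : ℝ) : ℂ) := by
    rw [ae_all_iff]
    intro p
    filter_upwards [Lp.coeFn_smul (psWeight s z p.1) (poissonL2 p.1), coeFn_poissonL2 p.1]
      with ζ h1 h2
    simp [h1, h2]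
  have hreal : ∀ᵐ ζ : Circle ∂circleMeasure,
      HasSum (fun p : X.Point => psWeight s z p.1 * poissonKernel 0 (p.1 : ℂ) ζ)
        (poissonSeries s z ζ X).toReal := by
    filter_upwards [hfin] with ζ h2
    have h3 := ENNReal.hasSum_toReal (f := fun p : X.Point =>
      ENNReal.ofReal (psWeight s z p.1 * poissonKernel 0 (p.1 : ℂ) ζ)) h2.ne
    rw [← ENNReal.tsum_toReal_eq fun p => ENNReal.ofReal_ne_top] at h3
    simpa only [poissonSeries, ENNReal.toReal_ofReal (psWeight_mul_poissonKernel_nonneg _ _ _ _)] using h3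
  have hsum : HasSum (fun p : X.Point => psWeight s z p.1 • poissonL2 p.1) (hG.toLp G) := by
    refine hasSum_toLp_of_dominated hG ?_ ?_
    · filter_upwards [hcoe, hreal] with ζ h1 h2
      simp only [h1]
      exact Complex.hasSum_ofReal.mpr h2
    · filter_upwards [hcoe, hreal] with ζ h1 h2 t
      simp only [h1, hGdef]
      rw [← Complex.ofReal_sum, Complex.norm_real, Complex.norm_real,
        Real.norm_of_nonneg (Finset.sum_nonneg fun p _ =>
          psWeight_mul_poissonKernel_nonneg _ _ _ _), Real.norm_of_nonneg ENNReal.toReal_nonneg]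
      exact sum_le_hasSum t (fun p _ => psWeight_mul_poissonKernel_nonneg _ _ _ _) h2
  refine ⟨hsum.summable, ?_⟩
  rw [hsum.tsum_eq, Lp.enorm_def, eLpNorm_two_sq]
  refine lintegral_congr_ae ?_
  filter_upwards [Lp.coeFn_sub (hG.toLp G) (a • poissonL2 z), hG.coeFn_toLp,
    Lp.coeFn_smul a (poissonL2 z), coeFn_poissonL2 z] with ζ h1 h2 h3 h4
  rw [h1, Pi.sub_apply, h2, h3, Pi.smul_apply, h4]
  simp [hGdef]

/-! ### Domination and interpolation -/

/-- The Poisson kernels are nonnegative functions, so the norm of a linear combination of them is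
monotone in the absolute values of the coefficients. -/
theorem norm_sum_smul_poissonL2_le {ι : Type*} (x : ι → Disk) (t : Finset ι) {a b : ι → ℝ}
    (hab : ∀ i, |a i| ≤ b i) :
    ‖∑ i ∈ t, a i • poissonL2 (x i)‖ ≤ ‖∑ i ∈ t, b i • poissonL2 (x i)‖ := by
  have hcoe : ∀ c : ι → ℝ, ⇑(∑ i ∈ t, c i • poissonL2 (x i)) =ᵐ[circleMeasure]
      fun ζ => ((∑ i ∈ t, c i * poissonKernel 0 (x i : ℂ) ζ : ℝ) : ℂ) := by
    intro c
    have h : ∀ᵐ ζ ∂circleMeasure, ∀ i ∈ t, (c i • poissonL2 (x i) : Lp ℂ 2 _) ζ =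
        ((c i * poissonKernel 0 (x i : ℂ) ζ : ℝ) : ℂ) := by
      refine (eventually_all_finset t).mpr fun i _ => ?_
      filter_upwards [Lp.coeFn_smul (c i) (poissonL2 (x i)), coeFn_poissonL2 (x i)] with ζ h1 h2
      simp [h1, h2]
    filter_upwards [Lp.coeFn_finsetSum t fun i => c i • poissonL2 (x i), h] with ζ h1 h2
    rw [h1, Finset.sum_apply, Complex.ofReal_sum]
    exact Finset.sum_congr rfl h2
  refine Lp.norm_le_norm_of_ae_le ?_
  filter_upwards [hcoe a, hcoe b] with ζ h1 h2
  rw [h1, h2, Complex.norm_real, Complex.norm_real]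
  have hb : 0 ≤ ∑ i ∈ t, b i * poissonKernel 0 (x i : ℂ) ζ := Finset.sum_nonneg fun i _ =>
    mul_nonneg ((abs_nonneg _).trans (hab i)) (poissonKernel_circle_nonneg _ _)
  rw [Real.norm_of_nonneg hb, Real.norm_eq_abs]
  refine (Finset.abs_sum_le_sum_abs _ _).trans (Finset.sum_le_sum fun i _ => ?_)
  rw [abs_mul, abs_of_nonneg (poissonKernel_circle_nonneg _ _)]
  exact mul_le_mul_of_nonneg_right (hab i) (poissonKernel_circle_nonneg _ _)

/-- Comparison test for unconditional convergence, with no absolute convergence in `L²(𝕋)`. -/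
theorem summable_smul_poissonL2_of_abs_le {ι : Type*} {x : ι → Disk} {a b : ι → ℝ}
    (hb : Summable fun i => b i • poissonL2 (x i)) (hab : ∀ i, |a i| ≤ b i) :
    Summable fun i => a i • poissonL2 (x i) := by
  rw [summable_iff_vanishing_norm] at hb ⊢
  intro ε hε
  obtain ⟨s, hs⟩ := hb ε hε
  exact ⟨s, fun t ht => (norm_sum_smul_poissonL2_le x t hab).trans_lt (hs t ht)⟩

theorem norm_tsum_smul_poissonL2_le {ι : Type*} {x : ι → Disk} {a b : ι → ℝ}
    (hb : Summable fun i => b i • poissonL2 (x i)) (hab : ∀ i, |a i| ≤ b i) :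
    ‖∑' i, a i • poissonL2 (x i)‖ ≤ ‖∑' i, b i • poissonL2 (x i)‖ :=
  le_of_tendsto_of_tendsto (summable_smul_poissonL2_of_abs_le hb hab).hasSum.norm hb.hasSum.norm
    (Eventually.of_forall fun t => norm_sum_smul_poissonL2_le x t hab)

/-- The sum `∑_{x ∈ X} e^{-s d(x, z)} P_x` in `L²(𝕋)`. -/
noncomputable def poissonSum (X : Conf Disk) (s : ℝ) (z : Disk) : Lp ℂ 2 circleMeasure :=
  ∑' p : X.Point, psWeight s z p.1 • poissonL2 p.1

/-- Exponents decreasing to `1`, fast enough for a Borel–Cantelli argument, but with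
`psMass (psExponent n) / psMass (psExponent (n + 1)) → 1`. -/
noncomputable def psExponent (n : ℕ) : ℝ := 1 + 1 / ((n : ℝ) + 1) ^ 2

theorem one_lt_psExponent (n : ℕ) : 1 < psExponent n := by
  unfold psExponent
  have : (0 : ℝ) < 1 / ((n : ℝ) + 1) ^ 2 := by positivity
  linarith

theorem psExponent_le_two (n : ℕ) : psExponent n ≤ 2 := by
  unfold psExponent
  have : 1 / ((n : ℝ) + 1) ^ 2 ≤ 1 := by
    rw [div_le_one (by positivity)]
    have : (0 : ℝ) ≤ n := n.cast_nonneg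
    nlinarith
  linarith

theorem tendsto_psExponent : Tendsto psExponent atTop (𝓝 1) := by
  have h := (tendsto_one_div_add_atTop_nhds_zero_nat (𝕜 := ℝ)).pow 2
  have h2 := h.const_add 1
  simp only [ne_eq, OfNat.ofNat_ne_zero, not_false_eq_true, zero_pow, add_zero] at h2
  refine h2.congr fun n => ?_
  simp [psExponent]

theorem tendsto_psMass_ratio :
    Tendsto (fun n => psMass (psExponent (n + 1)) / psMass (psExponent n)) atTop (𝓝 1) := by
  have h1 : Tendsto (fun n : ℕ => (1 + 1 / ((n : ℝ) + 1)) ^ 2) atTop (𝓝 1) := by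
    simpa using ((tendsto_one_div_add_atTop_nhds_zero_nat (𝕜 := ℝ)).const_add 1).pow 2
  have h2 : Tendsto (fun n : ℕ => (psExponent n + 1) / (psExponent (n + 1) + 1)) atTop (𝓝 1) := by
    have := (tendsto_psExponent.add_const 1).div
      ((tendsto_psExponent.comp (tendsto_add_atTop_nat 1)).add_const 1) (by norm_num)
    rwa [div_self (by norm_num)] at this
  have h3 := h1.mul h2
  rw [mul_one] at h3
  refine h3.congr fun n => ?_
  have hn : (0 : ℝ) < (n : ℝ) + 1 := by positivity
  have hn2 : (0 : ℝ) < (n : ℝ) + 1 + 1 := by positivity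
  have ha := one_lt_psExponent n
  have hb := one_lt_psExponent (n + 1)
  have ha1 : psExponent n ^ 2 - 1 = 1 / ((n : ℝ) + 1) ^ 2 * (psExponent n + 1) := by
    have : psExponent n - 1 = 1 / ((n : ℝ) + 1) ^ 2 := by simp [psExponent]
    rw [← this]; ring
  have hb1 : psExponent (n + 1) ^ 2 - 1 =
      1 / ((n : ℝ) + 1 + 1) ^ 2 * (psExponent (n + 1) + 1) := by
    have : psExponent (n + 1) - 1 = 1 / ((n : ℝ) + 1 + 1) ^ 2 := by simp [psExponent]
    rw [← this]; ring
  have ha2 : psExponent n + 1 ≠ 0 := by linarith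
  have hb2 : psExponent (n + 1) + 1 ≠ 0 := by linarith
  have hpi := Real.pi_pos.ne'
  unfold psMass
  rw [ha1, hb1]
  field_simp

/-- The index `n` with `psExponent (n + 1) < s ≤ psExponent n`, for `1 < s ≤ 2`. -/
noncomputable def psIndex (s : ℝ) : ℕ := ⌊(√(s - 1))⁻¹⌋₊ - 1

theorem tendsto_psIndex : Tendsto psIndex (𝓝[>] 1) atTop := by
  refine (tendsto_sub_atTop_nat 1).comp (tendsto_nat_floor_atTop.comp
    (tendsto_inv_nhdsGT_zero.comp ?_))
  refine tendsto_nhdsWithin_iff.mpr ⟨?_, ?_⟩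
  · have : Continuous fun s : ℝ => √(s - 1) := by fun_prop
    simpa using (this.tendsto 1).mono_left nhdsWithin_le_nhds
  · filter_upwards [self_mem_nhdsWithin] with s hs
    exact Real.sqrt_pos.mpr (sub_pos.mpr hs)

theorem psExponent_psIndex {s : ℝ} (hs : 1 < s) (hs2 : s ≤ 2) :
    psExponent (psIndex s + 1) ≤ s ∧ s ≤ psExponent (psIndex s) := by
  set q := √(s - 1) with hq
  have hq0 : 0 < q := Real.sqrt_pos.mpr (sub_pos.mpr hs)
  have hqs : q ^ 2 = s - 1 := Real.sq_sqrt (by linarith)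
  have hq1 : 1 ≤ q⁻¹ := by
    rw [one_le_inv₀ hq0]
    nlinarith
  have hfl : 1 ≤ ⌊q⁻¹⌋₊ := Nat.le_floor (by exact_mod_cast hq1)
  have hidx : (psIndex s : ℝ) + 1 = ⌊q⁻¹⌋₊ := by
    unfold psIndex
    rw [← hq]
    exact_mod_cast Nat.sub_add_cancel hfl
  have h1 : (psIndex s : ℝ) + 1 ≤ q⁻¹ := hidx ▸ Nat.floor_le (by positivity)
  have h2 : q⁻¹ < (psIndex s : ℝ) + 1 + 1 := hidx ▸ Nat.lt_floor_add_one _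
  have hn : (0 : ℝ) < (psIndex s : ℝ) + 1 := by positivity
  unfold psExponent
  push_cast
  constructor
  · have : 1 / ((psIndex s : ℝ) + 1 + 1) ^ 2 ≤ q ^ 2 := by
      rw [one_div, ← inv_pow]
      gcongr
      exact inv_le_of_inv_le₀ hq0 h2.le
    linarith
  · have : q ^ 2 ≤ 1 / ((psIndex s : ℝ) + 1) ^ 2 := by
      rw [one_div, ← inv_pow]
      gcongr
      exact (le_inv_comm₀ hq0 hn).mpr h1
    linarith

section Deterministic

variable {X : Conf Disk} {lam : ℝ}

/-- The weights between two consecutive exponents are squeezed, so convergence along the sequence of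
exponents implies convergence as `s → 1⁺`. -/
theorem tendsto_poissonSum_of_tendsto_seq {z : Disk} (hlam : lam ≠ 0)
    (hsum : ∀ n, Summable fun p : X.Point => psWeight (psExponent n) z p.1 • poissonL2 p.1)
    (hlim : Tendsto (fun n => (lam * psMass (psExponent n))⁻¹ • poissonSum X (psExponent n) z)
      atTop (𝓝 (poissonL2 z))) :
    Tendsto (fun s => (lam * psMass (psExponent (psIndex s)))⁻¹ • poissonSum X s z)
      (𝓝[>] 1) (𝓝 (poissonL2 z)) := by
  set N : ℕ → ℝ := fun n => lam * psMass (psExponent n) with hN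
  have hN0 : ∀ n, N n ≠ 0 := fun n => mul_ne_zero hlam (psMass_pos (one_lt_psExponent n)).ne'
  have hratio : Tendsto (fun n => N (n + 1) / N n) atTop (𝓝 1) := by
    refine tendsto_psMass_ratio.congr fun n => ?_
    simp only [hN]
    rw [mul_div_mul_left _ _ hlam]
  have hnext : Tendsto (fun n => (N n)⁻¹ • poissonSum X (psExponent (n + 1)) z) atTop
      (𝓝 (poissonL2 z)) := by
    have := hratio.smul (hlim.comp (tendsto_add_atTop_nat 1))
    rw [one_smul] at this
    refine this.congr fun n => ?_
    simp only [Function.comp_apply]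
    rw [smul_smul, div_mul_eq_mul_div, mul_inv_cancel₀ (hN0 (n + 1)), one_div]
  have hdiff : Tendsto (fun n => ‖(N n)⁻¹ • poissonSum X (psExponent (n + 1)) z -
      (N n)⁻¹ • poissonSum X (psExponent n) z‖) atTop (𝓝 0) := by
    have := (hnext.sub hlim).norm
    rwa [sub_self, norm_zero] at this
  have hclose : Tendsto (fun s => (N (psIndex s))⁻¹ • poissonSum X s z -
      (N (psIndex s))⁻¹ • poissonSum X (psExponent (psIndex s)) z) (𝓝[>] 1) (𝓝 0) := by
    refine squeeze_zero_norm' ?_ (hdiff.comp tendsto_psIndex)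
    filter_upwards [Ioc_mem_nhdsGT (show (1 : ℝ) < 2 by norm_num)] with s hs
    obtain ⟨h1, h2⟩ := psExponent_psIndex hs.1 hs.2
    simp only [Function.comp_apply]
    rw [← smul_sub, ← smul_sub, norm_smul, norm_smul]
    refine mul_le_mul_of_nonneg_left ?_ (norm_nonneg _)
    have hs' : Summable fun p : X.Point => psWeight s z p.1 • poissonL2 p.1 :=
      summable_smul_poissonL2_of_abs_le (hsum (psIndex s + 1)) fun p => by
        rw [abs_of_pos (Disk.psWeight_pos _ _ _)]
        exact Disk.psWeight_anti h1 z p.1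
    unfold poissonSum
    rw [← hs'.tsum_sub (hsum _), ← (hsum _).tsum_sub (hsum _)]
    simp only [← sub_smul]
    refine norm_tsum_smul_poissonL2_le ?_ fun p => ?_
    · simp only [sub_smul]
      exact (hsum _).sub (hsum _)
    · rw [abs_of_nonneg (sub_nonneg.mpr (Disk.psWeight_anti h2 z p.1))]
      exact sub_le_sub_right (Disk.psWeight_anti h1 z p.1) _
  have := hclose.add (hlim.comp tendsto_psIndex)
  rw [zero_add] at this
  refine this.congr fun s => ?_
  simp [hN]

/-- Summability for one base point and exponents arbitrarily close to `1` gives summability for all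
base points and all exponents `s > 1`. -/
theorem summable_psWeight_smul_poissonL2 {w : Disk}
    (hsum : ∀ n, Summable fun p : X.Point => psWeight (psExponent n) w p.1 • poissonL2 p.1)
    {s : ℝ} (hs : 1 < s) (z : Disk) :
    Summable fun p : X.Point => psWeight s z p.1 • poissonL2 p.1 := by
  obtain ⟨n, hn⟩ := ((tendsto_order.mp tendsto_psExponent).2 s hs).exists
  have h := (hsum n).const_smul (Disk.harnackConst z w ^ psExponent n)
  simp only [smul_smul] at h
  refine summable_smul_poissonL2_of_abs_le h fun p => ?_
  rw [abs_of_pos (Disk.psWeight_pos _ _ _)]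
  exact (Disk.psWeight_anti hn.le z p.1).trans
    (Disk.psWeight_le_harnackConst_mul (zero_le_one.trans (one_lt_psExponent n).le) z w p.1)

theorem continuous_poissonL2 : Continuous poissonL2 := by
  have h : Continuous poissonC := by
    refine ContinuousMap.continuous_of_continuous_uncurry _ ?_
    exact Complex.continuous_ofReal.comp continuous_poissonKernel_uncurry
  exact (ContinuousMap.toLp 2 circleMeasure ℂ).continuous.comp h

theorem norm_poissonSum_sub_le {w : Disk} {s : ℝ}
    (hsum : ∀ z, Summable fun p : X.Point => psWeight s z p.1 • poissonL2 p.1)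
    (hs : 0 ≤ s) (hs2 : s ≤ 2) (z : Disk) :
    ‖poissonSum X s z - poissonSum X s w‖ ≤ Disk.harnackOsc z w * ‖poissonSum X s w‖ := by
  have h := (hsum w).const_smul (Disk.harnackOsc z w)
  have hle : ‖poissonSum X s z - poissonSum X s w‖ ≤ ‖Disk.harnackOsc z w • poissonSum X s w‖ := by
    unfold poissonSum
    rw [← (hsum z).tsum_sub (hsum w), ← (hsum w).tsum_const_smul]
    simp only [← sub_smul, smul_smul] at h ⊢
    exact norm_tsum_smul_poissonL2_le h fun p => Disk.abs_psWeight_sub_le hs hs2 z w p.1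
  rwa [norm_smul, Real.norm_of_nonneg (Disk.harnackOsc_nonneg z w)] at hle

/-- Convergence for a dense set of base points implies convergence for all base points, because the
weights for nearby base points have a ratio close to `1`, uniformly over the disk. -/
theorem tendsto_poissonSum_of_dense {D : Set Disk} (hD : Dense D) {N : ℝ → ℝ}
    (hsum : ∀ s, 1 < s → ∀ z, Summable fun p : X.Point => psWeight s z p.1 • poissonL2 p.1)
    (hlim : ∀ z ∈ D, Tendsto (fun s => N s • poissonSum X s z) (𝓝[>] 1) (𝓝 (poissonL2 z)))
    (z : Disk) : Tendsto (fun s => N s • poissonSum X s z) (𝓝[>] 1) (𝓝 (poissonL2 z)) := by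
  rw [Metric.tendsto_nhds]
  intro ε hε
  have h1 : Tendsto (fun w => Disk.harnackOsc z w * (‖poissonL2 w‖ + 1) + dist (poissonL2 w)
      (poissonL2 z)) (𝓝 z) (𝓝 0) := by
    have hc := continuous_poissonL2.tendsto z
    have ha := (Disk.tendsto_harnackOsc z).mul (hc.norm.add_const 1)
    have hb := tendsto_iff_dist_tendsto_zero.mp hc
    simpa using ha.add hb
  obtain ⟨w, hwD, hw⟩ := hD.inter_nhds_nonempty ((tendsto_order.mp h1).2 (ε / 2) (by linarith))
  simp only [mem_ofPred_eq] at hw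
  filter_upwards [Metric.tendsto_nhds.mp (hlim w hwD) (ε / 2) (by linarith),
    Metric.tendsto_nhds.mp (hlim w hwD) 1 one_pos,
    Ioc_mem_nhdsGT (show (1 : ℝ) < 2 by norm_num)] with s h2 h3 hs
  have h4 : dist (N s • poissonSum X s z) (N s • poissonSum X s w) ≤
      Disk.harnackOsc z w * (‖poissonL2 w‖ + 1) := by
    rw [dist_eq_norm, ← smul_sub, norm_smul]
    have h5 := norm_poissonSum_sub_le (w := w) (hsum s hs.1) (zero_le_one.trans hs.1.le) hs.2 z
    have h6 : ‖N s • poissonSum X s w‖ ≤ ‖poissonL2 w‖ + 1 := by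
      rw [dist_eq_norm] at h3
      linarith [norm_sub_norm_le (N s • poissonSum X s w) (poissonL2 w)]
    calc ‖N s‖ * ‖poissonSum X s z - poissonSum X s w‖
        ≤ ‖N s‖ * (Disk.harnackOsc z w * ‖poissonSum X s w‖) := by gcongr
      _ = Disk.harnackOsc z w * ‖N s • poissonSum X s w‖ := by rw [norm_smul]; ring
      _ ≤ _ := mul_le_mul_of_nonneg_left h6 (Disk.harnackOsc_nonneg z w)
  calc dist (N s • poissonSum X s z) (poissonL2 z)
      ≤ dist (N s • poissonSum X s z) (N s • poissonSum X s w) +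
        dist (N s • poissonSum X s w) (poissonL2 w) + dist (poissonL2 w) (poissonL2 z) :=
          dist_triangle4 _ _ _ _
    _ < ε := by linarith

end Deterministic

/-! ### Boundary functionals of the Hardy space -/

theorem circleAverage_poissonKernel_smul_of_complex {f : ℂ → ℂ} {r : ℝ}
    (hf : InnerProductSpace.HarmonicOnNhd f (Metric.closedBall 0 r)) {w : ℂ}
    (hw : w ∈ Metric.ball (0 : ℂ) r) :
    Real.circleAverage (poissonKernel 0 w • f) 0 r = f w := by
  have hr : 0 < r := Metric.pos_of_mem_ball hw
  have hcont : ContinuousOn (poissonKernel 0 w • f) (Metric.sphere 0 r) := by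
    refine ContinuousOn.smul ?_ (hf.continuousOn.mono Metric.sphere_subset_closedBall)
    rw [poissonKernel_eq_re_herglotzRieszKernel]
    refine Complex.continuous_re.comp_continuousOn ?_
    have := continuousOn_herglotzRieszKernel_sphere hw
    rwa [abs_of_pos hr] at this
  have hint : CircleIntegrable (poissonKernel 0 w • f) 0 r := hcont.circleIntegrable hr.le
  apply Complex.ext
  · have h1 := (hf.comp_CLM Complex.reCLM).circleAverage_poissonKernel_smul hw
    have h2 := Complex.reCLM.circleAverage_comp_comm hint
    rw [Complex.reCLM_apply] at h2
    rw [← h2, ← Complex.reCLM_apply, ← Function.comp_apply (f := Complex.reCLM), ← h1]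
    congr 1
    ext ζ
    simp
  · have h1 := (hf.comp_CLM Complex.imCLM).circleAverage_poissonKernel_smul hw
    have h2 := Complex.imCLM.circleAverage_comp_comm hint
    rw [Complex.imCLM_apply] at h2
    rw [← h2, ← Complex.imCLM_apply, ← Function.comp_apply (f := Complex.imCLM), ← h1]
    congr 1
    ext ζ
    simp

/-- For `r < 1`, the function `x ↦ f (r x)` is given by a functional on `L²(𝕋)` whose norm is the
root mean square of `f` on the circle of radius `r`. -/
theorem exists_functional_of_harmonic_dilation {f : ℂ → ℂ}
    (hf : InnerProductSpace.HarmonicOnNhd f (Metric.ball 0 1)) {r : ℝ} (hr : r ∈ Ioo (0 : ℝ) 1) :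
    ∃ φ : StrongDual ℂ (Lp ℂ 2 circleMeasure),
      ‖φ‖ ^ 2 = Real.circleAverage (fun z => ‖f z‖ ^ 2) 0 r ∧
        ∀ x : Disk, φ (poissonL2 x) = f (r * x) := by
  have hmem : ∀ ζ : Circle, (r : ℂ) * ζ ∈ Metric.ball (0 : ℂ) 1 := by
    intro ζ
    rw [mem_ball_zero_iff, norm_mul, Circle.norm_coe, mul_one, Complex.norm_real,
      Real.norm_of_nonneg hr.1.le]
    exact hr.2
  have hcont : Continuous fun ζ : Circle => f (r * ζ) :=
    hf.continuousOn.comp_continuous (by fun_prop) hmem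
  set g : C(Circle, ℂ) := ⟨fun ζ => conj (f (r * ζ)), Complex.continuous_conj.comp hcont⟩ with hg
  refine ⟨innerSL ℂ (ContinuousMap.toLp 2 circleMeasure ℂ g), ?_, fun x => ?_⟩
  · have h1 : inner ℂ (ContinuousMap.toLp 2 circleMeasure ℂ g)
        (ContinuousMap.toLp 2 circleMeasure ℂ g) =
          (‖ContinuousMap.toLp 2 circleMeasure ℂ g‖ : ℂ) ^ 2 := inner_self_eq_norm_sq_to_K _
    rw [← Complex.ofReal_pow, ContinuousMap.inner_toLp] at h1
    rw [innerSL_apply_norm, ← Complex.ofReal_inj, ← h1,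
      Real.circleAverage_eq_circleAverage_zero_one,
      ← integral_circleMeasure (g := fun z => ‖f (r * z + 0)‖ ^ 2)
        (by simpa [Pi.pow_def] using hcont.norm.pow 2), ← integral_complex_ofReal]
    refine integral_congr_ae (Eventually.of_forall fun ζ => ?_)
    simp [hg, Complex.conj_mul']
  · rw [innerSL_apply_apply, poissonL2, ContinuousMap.inner_toLp]
    have hball : (r : ℂ) * x ∈ Metric.ball (0 : ℂ) r := by
      rw [mem_ball_zero_iff, norm_mul, Complex.norm_real, Real.norm_of_nonneg hr.1.le]
      exact mul_lt_of_lt_one_right hr.1 x.norm_lt_one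
    have hscale : ∀ ζ : Circle, (poissonKernel 0 ((r : ℂ) * x) • f) (r * ζ + 0) =
        poissonC x ζ * f (r * ζ) := by
      intro ζ
      have : poissonKernel 0 ((r : ℂ) * x) (r * ζ) = poissonKernel 0 (x : ℂ) ζ := by
        have hr0 := hr.1.ne'
        rw [poissonKernel_def, poissonKernel_def]
        simp only [sub_zero, ← mul_sub, norm_mul, Complex.norm_real, mul_pow]
        rw [mul_div_mul_left]
        simpa using hr0
      simp [poissonC, this]
    rw [← circleAverage_poissonKernel_smul_of_complex
      (hf.mono (Metric.closedBall_subset_ball hr.2)) hball,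
      Real.circleAverage_eq_circleAverage_zero_one, ← integral_circleMeasure]
    · refine integral_congr_ae (Eventually.of_forall fun ζ => ?_)
      simp only [hscale]
      simp [hg]
    · simp only [hscale]
      exact (poissonC x).continuous.mul hcont

/-- Every function of the harmonic Hardy space is the Poisson integral of a bounded functional on
`L²(𝕋)`: a weak-* limit of the functionals of its dilations. -/
theorem exists_functional_of_mem_harmonicHardy {f : ℂ → ℂ} (hf : f ∈ harmonicHardy) :
    ∃ φ : StrongDual ℂ (Lp ℂ 2 circleMeasure), ∀ x : Disk, φ (poissonL2 x) = f x := by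
  obtain ⟨hharm, B, hB⟩ := hf
  have hB' : ∀ r ∈ Ioo (0 : ℝ) 1, Real.circleAverage (fun z => ‖f z‖ ^ 2) 0 r ≤ B := fun r hr =>
    hB ⟨r, hr, rfl⟩
  choose! Φ hΦ1 hΦ2 using fun (r : ℝ) (hr : r ∈ Ioo (0 : ℝ) 1) =>
    exists_functional_of_harmonic_dilation hharm hr
  have hev : ∀ᶠ r in 𝓝[<] (1 : ℝ), r ∈ Ioo (0 : ℝ) 1 := Ioo_mem_nhdsLT one_pos
  set U : Ultrafilter ℝ := Ultrafilter.of (𝓝[<] (1 : ℝ)) with hU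
  have hUle : (U : Filter ℝ) ≤ 𝓝[<] 1 := Ultrafilter.of_le _
  have hK := WeakDual.isCompact_closedBall (𝕜 := ℂ) (0 : StrongDual ℂ (Lp ℂ 2 circleMeasure)) (√B)
  obtain ⟨φ, -, hφ⟩ := hK.ultrafilter_le_nhds' (U.map fun r => StrongDual.toWeakDual (Φ r)) (by
    rw [Ultrafilter.mem_map]
    refine hUle (hev.mono fun r hr => ?_)
    show Φ r ∈ Metric.closedBall _ _
    rw [mem_closedBall_zero_iff]
    exact Real.le_sqrt_of_sq_le ((hΦ1 r hr).trans_le (hB' r hr)))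
  refine ⟨WeakDual.toStrongDual φ, fun x => ?_⟩
  have h1 : Tendsto (fun r => Φ r (poissonL2 x)) U (𝓝 (φ (poissonL2 x))) :=
    ((WeakDual.eval_continuous (poissonL2 x)).tendsto φ).comp hφ
  have h2 : Tendsto (fun r : ℝ => f (r * x)) U (𝓝 (f x)) := by
    have hc : ContinuousAt (fun r : ℝ => f (r * x)) 1 := by
      refine ContinuousAt.comp (g := f) ?_ (by fun_prop)
      rw [Complex.ofReal_one, one_mul]
      exact hharm.continuousOn.continuousAt (Metric.isOpen_ball.mem_nhds x.2)
    have := hc.tendsto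
    rw [Complex.ofReal_one, one_mul] at this
    exact this.mono_left (hUle.trans nhdsWithin_le_nhds)
  refine tendsto_nhds_unique h1 (h2.congr' ?_)
  filter_upwards [hUle hev] with r hr
  exact (hΦ2 r hr x).symm

/-! ### Almost sure convergence along a sequence of exponents -/

theorem ae_tendsto_zero_of_tsum_lintegral_ne_top {α : Type*} [MeasurableSpace α] {μ : Measure α}
    {f : ℕ → α → ℝ≥0∞} (hf : ∀ n, AEMeasurable (f n) μ) (h : ∑' n, ∫⁻ x, f n x ∂μ ≠ ∞) :
    ∀ᵐ x ∂μ, Tendsto (fun n => f n x) atTop (𝓝 0) := by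
  rw [← lintegral_tsum hf] at h
  filter_upwards [ae_lt_top' (AEMeasurable.tsum hf) h] with x hx
  exact ENNReal.tendsto_atTop_zero_of_tsum_ne_top hx.ne

section AlmostSure

variable {P : Measure (Conf Disk)} [SFinite P] {lam : ℝ} {C : ℝ≥0}

/-- For one base point, the normalized sums converge almost surely along the sequence of exponents:
their mean square distances from the limit are summable. -/
theorem ae_summable_and_tendsto_psExponent (hlam : 0 < lam)
    (hint : HasFirstIntensity P (ENNReal.ofReal lam • diskVolume))
    (hC : HasVarianceBoundWith P C) (z : Disk) :
    ∀ᵐ X ∂P,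
      (∀ n, Summable fun p : X.Point => psWeight (psExponent n) z p.1 • poissonL2 p.1) ∧
      Tendsto (fun n => (lam * psMass (psExponent n))⁻¹ • poissonSum X (psExponent n) z)
        atTop (𝓝 (poissonL2 z)) := by
  set N : ℕ → ℝ := fun n => lam * psMass (psExponent n) with hN
  have hN0 : ∀ n, 0 < N n := fun n => mul_pos hlam (psMass_pos (one_lt_psExponent n))
  set J : ℕ → Conf Disk → ℝ≥0∞ := fun n X =>
    ∫⁻ ζ, ‖((poissonSeries (psExponent n) z ζ X).toReal : ℂ) -
      (N n * poissonKernel 0 (z : ℂ) ζ : ℝ)‖ₑ ^ 2 ∂circleMeasure with hJ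
  have hJm : ∀ n, Measurable (J n) := fun n =>
    (measurable_enorm_poissonSeries_sub_sq (psExponent n) z (N n)).lintegral_prod_left'
  have hJle : ∀ n, ∫⁻ X, J n X ∂P ≤
      ENNReal.ofReal (C * Disk.harnackConst z 0 ^ psExponent n * N n) := fun n =>
    lintegral_lintegral_poissonSeries_sub_sq_le hlam hint hC (one_lt_psExponent n) z
  -- the expected square distance after normalization is of order `s - 1`, hence summable
  set M : ℝ := C * (max 1 (Disk.harnackConst z 0)) ^ 2 * (6 / (lam * Real.pi)) with hM
  have hM0 : 0 ≤ M := by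
    have := Real.pi_pos
    positivity
  have hbound : ∀ n, ENNReal.ofReal ((N n)⁻¹ ^ 2) * ∫⁻ X, J n X ∂P ≤
      ENNReal.ofReal (M * (1 / ((n : ℝ) + 1) ^ 2)) := by
    intro n
    refine (mul_le_mul_right (hJle n) _).trans ?_
    rw [← ENNReal.ofReal_mul (by positivity)]
    apply ENNReal.ofReal_le_ofReal
    have hK : Disk.harnackConst z 0 ^ psExponent n ≤ (max 1 (Disk.harnackConst z 0)) ^ 2 := by
      refine (Real.rpow_le_rpow (Disk.harnackConst_pos z 0).le (le_max_right 1 _)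
        (by linarith [one_lt_psExponent n])).trans ?_
      rw [← Real.rpow_two]
      exact Real.rpow_le_rpow_of_exponent_le (le_max_left _ _) (psExponent_le_two n)
    have hNinv : (N n)⁻¹ ≤ 6 / (lam * Real.pi) * (1 / ((n : ℝ) + 1) ^ 2) := by
      have h1 : psExponent n ^ 2 - 1 ≤ 3 * (1 / ((n : ℝ) + 1) ^ 2) := by
        have h2 : psExponent n - 1 = 1 / ((n : ℝ) + 1) ^ 2 := by simp [psExponent]
        have h3 := psExponent_le_two n
        have h4 := one_lt_psExponent n
        rw [← h2]
        nlinarith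
      have h5 : (N n)⁻¹ = 2 / (lam * Real.pi) * (psExponent n ^ 2 - 1) := by
        have h6 : psExponent n ^ 2 - 1 ≠ 0 := by nlinarith [one_lt_psExponent n]
        have := Real.pi_pos.ne'
        simp only [hN, psMass]
        field_simp
      have hpi := Real.pi_pos
      calc (N n)⁻¹ ≤ 2 / (lam * Real.pi) * (3 * (1 / ((n : ℝ) + 1) ^ 2)) := by
            rw [h5]; gcongr
        _ = _ := by ring
    have hNinv0 : 0 ≤ (N n)⁻¹ := (inv_pos.mpr (hN0 n)).le
    calc (N n)⁻¹ ^ 2 * (C * Disk.harnackConst z 0 ^ psExponent n * N n)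
        = C * Disk.harnackConst z 0 ^ psExponent n * (N n)⁻¹ := by
          have := (hN0 n).ne'
          field_simp
      _ ≤ C * (max 1 (Disk.harnackConst z 0)) ^ 2 *
            (6 / (lam * Real.pi) * (1 / ((n : ℝ) + 1) ^ 2)) := by gcongr
      _ = _ := by rw [hM]; ring
  have htsum : ∑' n, ∫⁻ X, ENNReal.ofReal ((N n)⁻¹ ^ 2) * J n X ∂P ≠ ∞ := by
    have hs : Summable fun n : ℕ => M * (1 / ((n : ℝ) + 1) ^ 2) := by
      refine Summable.mul_left _ ?_
      have := (summable_nat_add_iff 1).mpr (Real.summable_one_div_nat_pow.mpr one_lt_two)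
      simpa using this
    have hfin : ∑' n : ℕ, ENNReal.ofReal (M * (1 / ((n : ℝ) + 1) ^ 2)) ≠ ∞ := by
      rw [← ENNReal.ofReal_tsum_of_nonneg (fun n => by positivity) hs]
      exact ENNReal.ofReal_ne_top
    refine ne_top_of_le_ne_top hfin (ENNReal.tsum_le_tsum fun n => ?_)
    rw [lintegral_const_mul _ (hJm n)]
    exact hbound n
  have hlt : ∀ᵐ X ∂P, ∀ n, J n X < ∞ := ae_all_iff.mpr fun n =>
    ae_lt_top (hJm n) (ne_top_of_le_ne_top ENNReal.ofReal_ne_top (hJle n))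
  have hserlt : ∀ᵐ X ∂P, ∀ n, ∀ᵐ ζ ∂circleMeasure, poissonSeries (psExponent n) z ζ X < ∞ :=
    ae_all_iff.mpr fun n => ae_ae_poissonSeries_lt_top hlam hint (one_lt_psExponent n) z
  filter_upwards [ae_tendsto_zero_of_tsum_lintegral_ne_top
    (fun n => ((hJm n).const_mul _).aemeasurable) htsum, hlt, hserlt] with X h0 h1 h2
  have hL2 := fun n => summable_poissonL2_of_lintegral_lt_top (N n) (h2 n) (h1 n)
  refine ⟨fun n => (hL2 n).1, ?_⟩
  rw [tendsto_iff_edist_tendsto_0]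
  have hsq : Tendsto (fun n => (ENNReal.ofReal ((N n)⁻¹ ^ 2) * J n X) ^ (2⁻¹ : ℝ)) atTop
      (𝓝 (0 ^ (2⁻¹ : ℝ))) := (ENNReal.continuous_rpow_const.tendsto 0).comp h0
  rw [ENNReal.zero_rpow_of_pos (by norm_num)] at hsq
  refine hsq.congr fun n => ?_
  have hfac : (N n)⁻¹ • poissonSum X (psExponent n) z - poissonL2 z =
      (N n)⁻¹ • (poissonSum X (psExponent n) z - N n • poissonL2 z) := by
    rw [smul_sub, smul_smul, inv_mul_cancel₀ (hN0 n).ne', one_smul]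
  have hnorm : ENNReal.ofReal ((N n)⁻¹ ^ 2) * J n X =
      ‖(N n)⁻¹ • poissonSum X (psExponent n) z - poissonL2 z‖ₑ ^ 2 := by
    rw [hfac, enorm_smul, mul_pow, Real.enorm_of_nonneg (inv_pos.mpr (hN0 n)).le,
      ENNReal.ofReal_pow (inv_pos.mpr (hN0 n)).le]
    congr 1
    exact (hL2 n).2.symm
  rw [hnorm, edist_eq_enorm_sub, ← ENNReal.rpow_natCast, ← ENNReal.rpow_mul]
  simp [hN]

/-- Almost surely, the sums converge in `L²(𝕋)` for all exponents and base points, and after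
normalization by a deterministic function of `s` they converge to the Poisson kernels. -/
theorem ae_summable_and_tendsto_poissonSum (hlam : 0 < lam)
    (hint : HasFirstIntensity P (ENNReal.ofReal lam • diskVolume))
    (hC : HasVarianceBoundWith P C) :
    ∀ᵐ X ∂P,
      (∀ s, 1 < s → ∀ z, Summable fun p : X.Point => psWeight s z p.1 • poissonL2 p.1) ∧
      ∀ z, Tendsto (fun s => (lam * psMass (psExponent (psIndex s)))⁻¹ • poissonSum X s z)
        (𝓝[>] 1) (𝓝 (poissonL2 z)) := by
  obtain ⟨D, hDc, hD⟩ := TopologicalSpace.exists_countable_dense Disk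
  have hall := (ae_ball_iff hDc).mpr fun z _ => ae_summable_and_tendsto_psExponent hlam hint hC z
  filter_upwards [hall] with X hX
  obtain ⟨w, hw⟩ := hD.nonempty
  have hsum : ∀ s, 1 < s → ∀ z, Summable fun p : X.Point => psWeight s z p.1 • poissonL2 p.1 :=
    fun s hs z => summable_psWeight_smul_poissonL2 (hX w hw).1 hs z
  exact ⟨hsum, tendsto_poissonSum_of_dense hD hsum fun z hz =>
    tendsto_poissonSum_of_tendsto_seq hlam.ne' (hX z hz).1 (hX z hz).2⟩

end AlmostSure

/-! ### Reconstruction -/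

theorem one_mem_harmonicHardy : (fun _ => 1 : ℂ → ℂ) ∈ harmonicHardy := by
  refine ⟨InnerProductSpace.harmonicOnNhd_const 1, 1, ?_⟩
  rintro _ ⟨r, -, rfl⟩
  simp [Real.circleAverage_const]

theorem theorem1p4
    (P : Measure (Conf Disk)) [IsProbabilityMeasure P]
    (hvar : HasVarianceBound P)
    (lam : ℝ) (hlam : 0 < lam)
    (hint : HasFirstIntensity P (ENNReal.ofReal lam • diskVolume)) :
    ∀ᵐ X ∂P,
      -- (1) unconditional convergence in `L²(𝕋)`
      (∀ s : ℝ, 1 < s → ∀ z : Disk,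
        Summable fun p : X.Point => psWeight s z p.1 • poissonL2 p.1) ∧
      -- (2) the normalizing sums are finite and positive, and the averages converge to `P_z`
      (∀ z : Disk,
        (∀ s : ℝ, 1 < s → Summable (fun p : X.Point => psWeight s z p.1) ∧
          0 < ∑' p : X.Point, psWeight s z p.1) ∧
        Tendsto (fun s : ℝ =>
            ‖(∑' p : X.Point, psWeight s z p.1)⁻¹ •
              (∑' p : X.Point, psWeight s z p.1 • poissonL2 p.1) - poissonL2 z‖)
          (𝓝[>] 1) (𝓝 0)) ∧
      -- (3) absolute convergence and reconstruction, simultaneously for all of `h²(𝔻)`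
      (∀ f ∈ harmonicHardy, ∀ z : Disk,
        (∀ s : ℝ, 1 < s →
          Summable fun p : X.Point => ‖(psWeight s z p.1 : ℂ) * f p.1‖) ∧
        Tendsto (fun s : ℝ =>
            (∑' p : X.Point, (psWeight s z p.1 : ℂ) * f p.1) /
              ((∑' p : X.Point, psWeight s z p.1 : ℝ) : ℂ))
          (𝓝[>] 1) (𝓝 (f z))) := by
  obtain ⟨C, hC⟩ := hvar
  filter_upwards [ae_summable_and_tendsto_poissonSum hlam hint hC] with X hX
  obtain ⟨hsum, hlim⟩ := hX
  set N : ℝ → ℝ := fun s => lam * psMass (psExponent (psIndex s)) with hN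
  have hN0 : ∀ s, N s ≠ 0 := fun s => (mul_pos hlam (psMass_pos (one_lt_psExponent _))).ne'
  have hsmul : ∀ (φ : StrongDual ℂ (Lp ℂ 2 circleMeasure)) (a : ℝ) (v : Lp ℂ 2 circleMeasure),
      φ (a • v) = (a : ℂ) * φ v := fun φ a v => by
    rw [φ.map_smul_of_tower, Complex.real_smul]
  -- a functional on `L²(𝕋)` transfers the convergence to the values of a harmonic function
  have htransfer : ∀ {f : ℂ → ℂ} {φ : StrongDual ℂ (Lp ℂ 2 circleMeasure)},
      (∀ x : Disk, φ (poissonL2 x) = f x) → ∀ s, 1 < s → ∀ z,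
        HasSum (fun p : X.Point => (psWeight s z p.1 : ℂ) * f p.1) (φ (poissonSum X s z)) := by
    intro f φ hφ s hs z
    have h := (hsum s hs z).hasSum.mapL φ
    refine h.congr_fun fun p => ?_
    rw [hsmul, hφ]
  obtain ⟨φ₁, hφ₁⟩ := exists_functional_of_mem_harmonicHardy one_mem_harmonicHardy
  have hW : ∀ s, 1 < s → ∀ z,
      HasSum (fun p : X.Point => psWeight s z p.1) (φ₁ (poissonSum X s z)).re := by
    intro s hs z
    have := Complex.hasSum_re (htransfer (f := fun _ => 1) hφ₁ s hs z)
    simpa using this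
  have hWφ : ∀ s, 1 < s → ∀ z,
      ((∑' p : X.Point, psWeight s z p.1 : ℝ) : ℂ) = φ₁ (poissonSum X s z) := by
    intro s hs z
    rw [Complex.ofReal_tsum, ← (htransfer (f := fun _ => 1) hφ₁ s hs z).tsum_eq]
    simp
  -- for the empty configuration the limit would be `0`
  have hne : Nonempty X.Point := by
    by_contra hempty
    rw [not_nonempty_iff] at hempty
    have h0 : poissonL2 0 = 0 := by
      refine tendsto_nhds_unique (hlim 0) ?_
      simp [poissonSum]
    have h1 := hφ₁ 0
    simp [h0] at h1
  have hWpos : ∀ s, 1 < s → ∀ z, 0 < ∑' p : X.Point, psWeight s z p.1 := fun s hs z =>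
    (hW s hs z).summable.tsum_pos (fun p => (Disk.psWeight_pos s z p.1).le) hne.some
      (Disk.psWeight_pos s z _)
  have hnormal : ∀ z, Tendsto (fun s => (N s)⁻¹ * ∑' p : X.Point, psWeight s z p.1)
      (𝓝[>] 1) (𝓝 1) := by
    intro z
    have h1 := (Complex.continuous_re.tendsto _).comp ((φ₁.continuous.tendsto _).comp (hlim z))
    rw [hφ₁, Complex.one_re] at h1
    refine h1.congr' ?_
    filter_upwards [self_mem_nhdsWithin] with s hs
    simp only [Function.comp_apply]
    rw [hsmul, ← hWφ s hs z, ← Complex.ofReal_mul, Complex.ofReal_re]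
  have hmain : ∀ z, Tendsto (fun s => (∑' p : X.Point, psWeight s z p.1)⁻¹ • poissonSum X s z)
      (𝓝[>] 1) (𝓝 (poissonL2 z)) := by
    intro z
    have h1 := ((hnormal z).inv₀ one_ne_zero).smul (hlim z)
    rw [inv_one, one_smul] at h1
    refine h1.congr fun s => ?_
    rw [smul_smul]
    congr 1
    have := hN0 s
    change ((N s)⁻¹ * _)⁻¹ * (N s)⁻¹ = _
    rw [mul_inv, inv_inv, mul_right_comm, mul_inv_cancel₀ this, one_mul]
  refine ⟨hsum, fun z => ⟨fun s hs => ⟨(hW s hs z).summable, hWpos s hs z⟩, ?_⟩, ?_⟩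
  · exact tendsto_iff_norm_sub_tendsto_zero.mp (hmain z)
  · intro f hf z
    obtain ⟨φ, hφ⟩ := exists_functional_of_mem_harmonicHardy hf
    refine ⟨fun s hs => (htransfer hφ s hs z).summable.norm, ?_⟩
    have h1 := (φ.continuous.tendsto _).comp (hmain z)
    rw [hφ] at h1
    refine h1.congr' ?_
    filter_upwards [self_mem_nhdsWithin] with s hs
    simp only [Function.comp_apply]
    rw [hsmul, (htransfer hφ s hs z).tsum_eq, Complex.ofReal_inv, div_eq_inv_mul]
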